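/- Let $n\ge 1$, and let $\mathbb H_n$ be the Siegel upper half space of complex symmetric $n\times n$ matrices $Z=X+iY$ with $Y$ positive definite. For $g=\begin{pmatrix}A&B\\C&D\end{pmatrix}\in \mathrm{Sp}_{2n}(\mathbb R)$ and $Z\in\mathbb H_n$ put $gZ=(AZ+B)(CZ+D)^{-1}$ and $J(g,Z)=CZ+D$. Let $(\rho,V)$ be an irreducible finite-dimensional rational complex representation of $\mathrm{GL}_n(\mathbb C)$ with highest weight $\lambda_1\ge\dots\ge\lambda_n\ge 0$ (integers), and for $F:\mathbb H_n\to V$ put $(F|_\rho g)(Z)=\rho(J(g,Z))^{-1}F(gZ)$. For an integer $p\ge 0$ let $T_n^p$ be the set of families $b=(b_{ij})_{1\le i\le j\le n}$ of non-negative integers with $\sum b_{ij}\le p$, and for a symmetric real matrix $U=(u_{ij})$ let $[U]^b=\prod_{i\le j}u_{ij}^{b_{ij}}$. Let $N^p(\mathbb H_n)$ be the space of functions $f(Z)=\sum_{b\in T_n^p}G_b(Z)[Y^{-1}]^b$ with all $G_b$ holomorphic on $\mathbb H_n$. Such an $f$ has a nice Fourier expansion if for some integer $N\ge1$ there are complex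 numbers $a_b(S)$ with $$f(Z)=\sum_{b\in T_n^p}\ \sum_{0\le S\in\frac1N M_n^{\mathrm{sym}}(\mathbb Z)}a_b(S)\,e^{2\pi i\,\mathrm{Tr}(SZ)}[Y^{-1}]^b,$$ the sum converging absolutely, and uniformly on compact subsets of $\mathbb H_n$. A congruence subgroup is a subgroup of $\mathrm{Sp}_{2n}(\mathbb Q)$ that is commensurable with $\mathrm{Sp}_{2n}(\mathbb Z)$ and contains a principal congruence subgroup of $\mathrm{Sp}_{2n}(\mathbb Z)$. Let $N_\rho^{(n)}$ be the set of nearly holomorphic Siegel modular forms of weight $\rho$: the functions $F:\mathbb H_n\to V$ for which there are a congruence subgroup $\Gamma$ and an integer $p\ge0$ such that $F|_\rho\gamma=F$ for all $\gamma\in\Gamma$ and, for every $g\in\mathrm{Sp}_{2n}(\mathbb Q)$ and every linear map $\ell:V\to\mathbb C$, the function $\ell\circ(F|_\rho g)$ lies in $N^p(\mathbb H_n)$ and has a nice Fourier expansion (with this $p$). **Theorem.** Let $F\in N_\rho^{(n)}$, let $\vec\Phi_F(g)=\rho(J(g,i1_n))^{-1}F(g\cdot i1_n)$ for $g\in\mathrm{Sp}_{2n}(\mathbb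 R)$, let $L:V\to\mathbb C$ be a linear functional, and let $\Phi_F=L\circ\vec\Phi_F$. Then $\Phi_F$ has moderate growth: there are a constant $C$ and a positive integer $r$ such that $$|\Phi_F(g)|\le C\,\mathrm{Tr}(g^*g)^r\qquad\text{for all }g\in\mathrm{Sp}_{2n}(\mathbb R).$$ More precisely, there is a constant $C$ (depending on $F$ and $L$) such that this inequality holds for every real $r\ge n\lambda_1/2$ and all $g\in\mathrm{Sp}_{2n}(\mathbb R)$. -/

import Mathlib

open Matrix

/-! ### The Siegel upper half space -/

/-- The Siegel upper half space `ℍ_n`: the complex symmetric `n × n` matrices `Z = X + iY` whose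
imaginary part `Y` is positive definite. -/
def SiegelUpperHalfSpace (n : ℕ) : Set (Matrix (Fin n) (Fin n) ℂ) :=
  {Z | Z.IsSymm ∧ (Z.map Complex.im).PosDef}

namespace SiegelUpperHalfSpace

variable {n : ℕ}

/-- The imaginary part `Y` of `Z = X + iY`. -/
def imPart (Z : SiegelUpperHalfSpace n) : Matrix (Fin n) (Fin n) ℝ :=
  (Z : Matrix (Fin n) (Fin n) ℂ).map Complex.im

/-- The base point `i · 1_n` of `ℍ_n`. -/
noncomputable def basePoint (n : ℕ) : SiegelUpperHalfSpace n :=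
  ⟨Complex.I • (1 : Matrix (Fin n) (Fin n) ℂ), by
    refine ⟨by simp [Matrix.IsSymm], ?_⟩
    have h : (Complex.I • (1 : Matrix (Fin n) (Fin n) ℂ)).map Complex.im = 1 := by
      ext i j
      by_cases hij : i = j <;> simp [Matrix.one_apply, hij]
    rw [h]
    exact Matrix.PosDef.one⟩

/-- The set `R_n = {(i, j) : i ≤ j}` of positions on or above the diagonal. -/
abbrev UpperIndex (n : ℕ) : Type := {ij : Fin n × Fin n // ij.1 ≤ ij.2}

/-- The coordinates `(Z_{ij})_{i ≤ j}`, which identify `ℍ_n` with an open subset of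
`ℂ^{n(n+1)/2}`. -/
def coords (Z : SiegelUpperHalfSpace n) : UpperIndex n → ℂ :=
  fun ij => (Z : Matrix (Fin n) (Fin n) ℂ) ij.1.1 ij.1.2

/-- `G : ℍ_n → ℂ` is holomorphic: it is a complex differentiable function of the coordinates
`(Z_{ij})_{i ≤ j}` on the open set `coords(ℍ_n)`. -/
def IsHolomorphic (G : SiegelUpperHalfSpace n → ℂ) : Prop :=
  ∃ g : (UpperIndex n → ℂ) → ℂ,
    DifferentiableOn ℂ g (Set.range (coords (n := n))) ∧ ∀ Z, G Z = g (coords Z)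

end SiegelUpperHalfSpace

/-! ### The symplectic group and its action -/

namespace SiegelForms

open SiegelUpperHalfSpace

variable {n : ℕ}

/-- `Sp_{2n}(R)`, in `n × n` blocks, for the standard alternating form. -/
abbrev Sp (n : ℕ) (R : Type) [CommRing R] : Type := Matrix.symplecticGroup (Fin n) R

/-- The entrywise map `Sp_{2n}(R) → Sp_{2n}(S)` induced by a ring homomorphism `R → S`. -/
def spMap {R S : Type} [CommRing R] [CommRing S] (f : R →+* S) : Sp n R →* Sp n S where
  toFun g := ⟨(g : Matrix (Fin n ⊕ Fin n) (Fin n ⊕ Fin n) R).map f, SymplecticGroup.map_mem g.2 f⟩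
  map_one' := by
    apply Subtype.ext
    simp
  map_mul' g h := by
    apply Subtype.ext
    simp [Matrix.map_mul]

/-- The block `A` of `g = [A B; C D]`, as a complex matrix. -/
def blockA (g : Sp n ℝ) : Matrix (Fin n) (Fin n) ℂ :=
  (g : Matrix (Fin n ⊕ Fin n) (Fin n ⊕ Fin n) ℝ).toBlocks₁₁.map Complex.ofReal
/-- The block `B` of `g = [A B; C D]`, as a complex matrix. -/
def blockB (g : Sp n ℝ) : Matrix (Fin n) (Fin n) ℂ :=
  (g : Matrix (Fin n ⊕ Fin n) (Fin n ⊕ Fin n) ℝ).toBlocks₁₂.map Complex.ofReal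
/-- The block `C` of `g = [A B; C D]`, as a complex matrix. -/
def blockC (g : Sp n ℝ) : Matrix (Fin n) (Fin n) ℂ :=
  (g : Matrix (Fin n ⊕ Fin n) (Fin n ⊕ Fin n) ℝ).toBlocks₂₁.map Complex.ofReal
/-- The block `D` of `g = [A B; C D]`, as a complex matrix. -/
def blockD (g : Sp n ℝ) : Matrix (Fin n) (Fin n) ℂ :=
  (g : Matrix (Fin n ⊕ Fin n) (Fin n ⊕ Fin n) ℝ).toBlocks₂₂.map Complex.ofReal

/-- The numerator `AZ + B` of the action. -/
def numMatrix (g : Sp n ℝ) (Z : SiegelUpperHalfSpace n) : Matrix (Fin n) (Fin n) ℂ :=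
  blockA g * Z + blockB g

/-- The matrix `J(g, Z) = CZ + D`. -/
def denomMatrix (g : Sp n ℝ) (Z : SiegelUpperHalfSpace n) : Matrix (Fin n) (Fin n) ℂ :=
  blockC g * Z + blockD g

theorem block_relations (g : Sp n ℝ) :
    (blockA g)ᵀ * blockC g = (blockC g)ᵀ * blockA g ∧
    (blockB g)ᵀ * blockD g = (blockD g)ᵀ * blockB g ∧
    (blockA g)ᵀ * blockD g - (blockC g)ᵀ * blockB g = 1 := by
  have h := g.2
  rw [← Matrix.fromBlocks_toBlocks (g : Matrix (Fin n ⊕ Fin n) (Fin n ⊕ Fin n) ℝ),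
    SymplecticGroup.fromBlocks_mem_iff] at h
  obtain ⟨h1, h2, h3⟩ := h
  have e (M N : Matrix (Fin n) (Fin n) ℝ) : (M.map Complex.ofReal)ᵀ * N.map Complex.ofReal
      = (Mᵀ * N).map Complex.ofReal := by
    rw [← Matrix.transpose_map]
    exact (Matrix.map_mul (f := Complex.ofRealHom)).symm
  refine ⟨?_, ?_, ?_⟩
  · simp only [blockA, blockC, e, h1]
  · simp only [blockB, blockD, e, h2]
  · simp only [blockA, blockB, blockC, blockD, e]
    rw [← Matrix.map_sub Complex.ofReal (by intros; simp), h3]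
    simp

theorem block_star (M : Matrix (Fin n) (Fin n) ℝ) :
    (M.map Complex.ofReal)ᴴ = (M.map Complex.ofReal)ᵀ := by
  ext i j
  simp

theorem num_transpose_mul_denom (g : Sp n ℝ) (Z : SiegelUpperHalfSpace n) :
    (numMatrix g Z)ᵀ * denomMatrix g Z = (denomMatrix g Z)ᵀ * numMatrix g Z := by
  obtain ⟨h1, h2, h3⟩ := block_relations g
  have h4 : (blockD g)ᵀ * blockA g - (blockB g)ᵀ * blockC g = 1 := by
    simpa using congrArg Matrix.transpose h3
  have hZ : (Z : Matrix (Fin n) (Fin n) ℂ)ᵀ = Z := Z.2.1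
  simp only [numMatrix, denomMatrix, Matrix.transpose_add, Matrix.transpose_mul, hZ]
  generalize (Z : Matrix (Fin n) (Fin n) ℂ) = W
  rw [← sub_eq_zero]
  have : (W * (blockA g)ᵀ + (blockB g)ᵀ) * (blockC g * W + blockD g) -
      (W * (blockC g)ᵀ + (blockD g)ᵀ) * (blockA g * W + blockB g) =
      W * ((blockA g)ᵀ * blockC g - (blockC g)ᵀ * blockA g) * W
      + W * ((blockA g)ᵀ * blockD g - (blockC g)ᵀ * blockB g)
      - ((blockD g)ᵀ * blockA g - (blockB g)ᵀ * blockC g) * W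
      + ((blockB g)ᵀ * blockD g - (blockD g)ᵀ * blockB g) := by noncomm_ring
  rw [this, h1, h2, h3, h4]
  simp

theorem denom_star_mul_num (g : Sp n ℝ) (Z : SiegelUpperHalfSpace n) :
    (denomMatrix g Z)ᴴ * numMatrix g Z - (numMatrix g Z)ᴴ * denomMatrix g Z =
      (2 * Complex.I) • (imPart Z).map Complex.ofReal := by
  obtain ⟨h1, h2, h3⟩ := block_relations g
  have h4 : (blockD g)ᵀ * blockA g - (blockB g)ᵀ * blockC g = 1 := by
    simpa using congrArg Matrix.transpose h3
  have hY : (Z : Matrix (Fin n) (Fin n) ℂ) - (Z : Matrix (Fin n) (Fin n) ℂ)ᴴ =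
      (2 * Complex.I) • (imPart Z).map Complex.ofReal := by
    ext i j
    have hZ : (Z : Matrix (Fin n) (Fin n) ℂ) j i = (Z : Matrix (Fin n) (Fin n) ℂ) i j :=
      Z.2.1.apply i j
    simp only [imPart, Matrix.sub_apply, Matrix.conjTranspose_apply, Matrix.smul_apply,
      Matrix.map_apply, hZ, smul_eq_mul]
    apply Complex.ext <;> simp
    ring
  rw [← hY]
  have sA : (blockA g)ᴴ = (blockA g)ᵀ := block_star _
  have sB : (blockB g)ᴴ = (blockB g)ᵀ := block_star _
  have sC : (blockC g)ᴴ = (blockC g)ᵀ := block_star _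
  have sD : (blockD g)ᴴ = (blockD g)ᵀ := block_star _
  simp only [numMatrix, denomMatrix, Matrix.conjTranspose_add, Matrix.conjTranspose_mul,
    sA, sB, sC, sD]
  generalize (Z : Matrix (Fin n) (Fin n) ℂ) = W
  have : (Wᴴ * (blockC g)ᵀ + (blockD g)ᵀ) * (blockA g * W + blockB g) -
      (Wᴴ * (blockA g)ᵀ + (blockB g)ᵀ) * (blockC g * W + blockD g) =
      ((blockD g)ᵀ * blockA g - (blockB g)ᵀ * blockC g) * W
      - Wᴴ * ((blockA g)ᵀ * blockD g - (blockC g)ᵀ * blockB g)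
      - Wᴴ * ((blockA g)ᵀ * blockC g - (blockC g)ᵀ * blockA g) * W
      - ((blockB g)ᵀ * blockD g - (blockD g)ᵀ * blockB g) := by noncomm_ring
  rw [this, h1, h2, h3, h4]
  simp

theorem quadForm_re_pos {Y : Matrix (Fin n) (Fin n) ℝ} (hY : Y.PosDef) {u : Fin n → ℂ}
    (hu : u ≠ 0) : 0 < (star u ⬝ᵥ (Y.map Complex.ofReal *ᵥ u)).re := by
  set a : Fin n → ℝ := fun i => (u i).re with ha
  set b : Fin n → ℝ := fun i => (u i).im with hb
  have key : (star u ⬝ᵥ (Y.map Complex.ofReal *ᵥ u)).re = a ⬝ᵥ (Y *ᵥ a) + b ⬝ᵥ (Y *ᵥ b) := by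
    simp only [dotProduct, mulVec, ha, hb, Complex.re_sum, Finset.mul_sum, ← Finset.sum_add_distrib]
    refine Finset.sum_congr rfl fun i _ => Finset.sum_congr rfl fun j _ => ?_
    simp
  have nonneg (x : Fin n → ℝ) : 0 ≤ x ⬝ᵥ (Y *ᵥ x) := by
    simpa using hY.posSemidef.dotProduct_mulVec_nonneg x
  have pos {x : Fin n → ℝ} (hx : x ≠ 0) : 0 < x ⬝ᵥ (Y *ᵥ x) := by
    simpa using hY.dotProduct_mulVec_pos hx
  rw [key]
  by_cases h0 : a = 0
  · have : b ≠ 0 := by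
      intro h1
      apply hu
      ext i
      exact Complex.ext (congrFun h0 i) (congrFun h1 i)
    exact add_pos_of_nonneg_of_pos (nonneg a) (pos this)
  · exact add_pos_of_pos_of_nonneg (pos h0) (nonneg b)

theorem im_quadForm (g : Sp n ℝ) (Z : SiegelUpperHalfSpace n) (u : Fin n → ℂ) :
    (star (denomMatrix g Z *ᵥ u) ⬝ᵥ (numMatrix g Z *ᵥ u)).im =
      (star u ⬝ᵥ ((imPart Z).map Complex.ofReal *ᵥ u)).re := by
  have h := congrArg (fun M => star u ⬝ᵥ (M *ᵥ u)) (denom_star_mul_num g Z)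
  simp only [Matrix.sub_mulVec, dotProduct_sub, Matrix.smul_mulVec, dotProduct_smul,
    ← Matrix.mulVec_mulVec, Matrix.dotProduct_mulVec (star u) (_ᴴ), ← Matrix.star_mulVec] at h
  have hs : star (numMatrix g Z *ᵥ u) ⬝ᵥ (denomMatrix g Z *ᵥ u) =
      star (star (denomMatrix g Z *ᵥ u) ⬝ᵥ (numMatrix g Z *ᵥ u)) := by
    simp [dotProduct, star_sum, mul_comm]
  rw [hs] at h
  have := congrArg Complex.im h
  simp at this
  linarith

/-- `CZ + D` is invertible. -/
theorem isUnit_det_denom (g : Sp n ℝ) (Z : SiegelUpperHalfSpace n) :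
    IsUnit (denomMatrix g Z).det := by
  rw [isUnit_iff_ne_zero]
  intro h0
  obtain ⟨u, hu, hu0⟩ := Matrix.exists_mulVec_eq_zero_iff.mpr h0
  have h1 := im_quadForm g Z u
  have h2 := quadForm_re_pos Z.2.2 hu
  rw [hu0] at h1
  simp only [star_zero, zero_dotProduct, Complex.zero_im] at h1
  exact absurd h1 h2.ne

theorem action_mem (g : Sp n ℝ) (Z : SiegelUpperHalfSpace n) :
    numMatrix g Z * (denomMatrix g Z)⁻¹ ∈ SiegelUpperHalfSpace n := by
  have hu := isUnit_det_denom g Z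
  have hsymm : (numMatrix g Z * (denomMatrix g Z)⁻¹).IsSymm := by
    have h := num_transpose_mul_denom g Z
    have hut : IsUnit (denomMatrix g Z)ᵀ.det := by rwa [Matrix.det_transpose]
    rw [Matrix.IsSymm, Matrix.transpose_mul, Matrix.transpose_nonsing_inv]
    calc ((denomMatrix g Z)ᵀ)⁻¹ * (numMatrix g Z)ᵀ
        = ((denomMatrix g Z)ᵀ)⁻¹ * ((numMatrix g Z)ᵀ * denomMatrix g Z) * (denomMatrix g Z)⁻¹ := by
          rw [← Matrix.mul_assoc, Matrix.mul_nonsing_inv_cancel_right _ _ hu]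
      _ = numMatrix g Z * (denomMatrix g Z)⁻¹ := by
          rw [h, Matrix.nonsing_inv_mul_cancel_left _ _ hut]
  refine ⟨hsymm, Matrix.PosDef.of_dotProduct_mulVec_pos ?_ ?_⟩
  · ext i j
    simp only [Matrix.conjTranspose_apply, Matrix.map_apply, star_trivial]
    rw [hsymm.apply i j]
  · intro x hx
    set w : Fin n → ℂ := fun i => (x i : ℂ) with hw
    set u : Fin n → ℂ := (denomMatrix g Z)⁻¹ *ᵥ w with hudef
    have hQu : denomMatrix g Z *ᵥ u = w := by
      rw [hudef, Matrix.mulVec_mulVec, Matrix.mul_nonsing_inv _ hu, Matrix.one_mulVec]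
    have hu0 : u ≠ 0 := by
      intro h0
      rw [h0, Matrix.mulVec_zero] at hQu
      apply hx
      ext i
      have := congrFun hQu i
      simpa [hw] using this.symm
    have h1 := im_quadForm g Z u
    have h2 := quadForm_re_pos Z.2.2 hu0
    rw [hQu, hudef, Matrix.mulVec_mulVec, ← hudef] at h1
    have h3 : (star w ⬝ᵥ ((numMatrix g Z * (denomMatrix g Z)⁻¹) *ᵥ w)).im =
        star x ⬝ᵥ ((numMatrix g Z * (denomMatrix g Z)⁻¹).map Complex.im *ᵥ x) := by
      simp only [dotProduct, mulVec, hw, Complex.im_sum, Finset.mul_sum]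
      refine Finset.sum_congr rfl fun i _ => Finset.sum_congr rfl fun j _ => ?_
      simp
    rw [← h3, h1]
    exact h2

/-- The action `gZ = (AZ + B)(CZ + D)⁻¹` of `Sp_{2n}(ℝ)` on `ℍ_n`. -/
noncomputable def act (g : Sp n ℝ) (Z : SiegelUpperHalfSpace n) : SiegelUpperHalfSpace n :=
  ⟨numMatrix g Z * (denomMatrix g Z)⁻¹, action_mem g Z⟩

/-- The factor of automorphy `J(g, Z) = CZ + D`, as an element of `GL_n(ℂ)`. -/
noncomputable def autFactor (g : Sp n ℝ) (Z : SiegelUpperHalfSpace n) :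
    Matrix.GeneralLinearGroup (Fin n) ℂ :=
  Matrix.GeneralLinearGroup.mk'' (denomMatrix g Z) (isUnit_det_denom g Z)

/-! ### Nearly holomorphic functions and Fourier expansions -/

/-- The set `T_n^p` of exponents `b = (b_{ij})_{i ≤ j}` of non-negative integers whose sum is at
most `p`. -/
def exponents (n p : ℕ) : Finset (UpperIndex n → ℕ) :=
  (Fintype.piFinset fun _ => Finset.range (p + 1)).filter fun b => ∑ ij, b ij ≤ p

theorem mem_exponents {p : ℕ} {b : UpperIndex n → ℕ} :
    b ∈ exponents n p ↔ ∑ ij, b ij ≤ p := by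
  simp only [exponents, Finset.mem_filter, Fintype.mem_piFinset, Finset.mem_range,
    and_iff_right_iff_imp]
  intro h ij
  exact Nat.lt_succ_of_le ((Finset.single_le_sum (fun _ _ => Nat.zero_le _)
    (Finset.mem_univ ij)).trans h)

/-- The monomial `[V]^b = ∏_{i ≤ j} v_{ij}^{b_{ij}}`. -/
def monomial (V : Matrix (Fin n) (Fin n) ℝ) (b : UpperIndex n → ℕ) : ℝ :=
  ∏ ij, V ij.1.1 ij.1.2 ^ b ij

/-- `N^p(ℍ_n)`: the polynomials of total degree at most `p` in the entries of `Y⁻¹`, with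
holomorphic functions on `ℍ_n` as coefficients. -/
def IsNearlyHolomorphic (p : ℕ) (f : SiegelUpperHalfSpace n → ℂ) : Prop :=
  ∃ G : (UpperIndex n → ℕ) → SiegelUpperHalfSpace n → ℂ,
    (∀ b ∈ exponents n p, IsHolomorphic (G b)) ∧
    ∀ Z, f Z = ∑ b ∈ exponents n p, G b Z * (monomial (imPart Z)⁻¹ b : ℂ)

/-- The positive semidefinite matrices in `(1/N) M_n^sym(ℤ)`. -/
def latticePSD (n N : ℕ) : Set (Matrix (Fin n) (Fin n) ℝ) :=
  {S | S.PosSemidef ∧ ∃ T : Matrix (Fin n) (Fin n) ℤ,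
    T.IsSymm ∧ S = (1 / (N : ℝ)) • T.map (Int.cast : ℤ → ℝ)}

/-- The term `a_b(S) e^{2πi Tr(SZ)} [Y⁻¹]^b` of a Fourier expansion. -/
noncomputable def fourierTerm {p N : ℕ} (a : exponents n p → latticePSD n N → ℂ)
    (x : exponents n p × latticePSD n N) (Z : SiegelUpperHalfSpace n) : ℂ :=
  a x.1 x.2 *
    Complex.exp (2 * Real.pi * Complex.I *
      ((x.2 : Matrix (Fin n) (Fin n) ℝ).map Complex.ofReal * (Z : Matrix (Fin n) (Fin n) ℂ)).trace) *
    (monomial (imPart Z)⁻¹ x.1 : ℂ)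

/-- `f ∈ N^p(ℍ_n)` has a nice Fourier expansion: it is the sum of a series of terms
`a_b(S) e^{2πi Tr(SZ)} [Y⁻¹]^b` with `b ∈ T_n^p` and `0 ≤ S ∈ (1/N) M_n^sym(ℤ)`, converging
absolutely, and uniformly on compact subsets of `ℍ_n`. -/
def HasNiceFourierExpansion (p : ℕ) (f : SiegelUpperHalfSpace n → ℂ) : Prop :=
  ∃ N : ℕ, 0 < N ∧ ∃ a : exponents n p → latticePSD n N → ℂ,
    (∀ Z, Summable fun x => ‖fourierTerm a x Z‖) ∧
    ∀ K : Set (SiegelUpperHalfSpace n), IsCompact K → HasSumUniformlyOn (fourierTerm a) f K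

/-! ### Representations of `GL_n(ℂ)` -/

section Representations

variable {V : Type*} [AddCommGroup V] [Module ℂ V]

/-- The representation `ρ` of `GL_n(ℂ)` is rational: every matrix coefficient is a polynomial in
the matrix entries and `det⁻¹`. -/
def IsRational (ρ : Representation ℂ (Matrix.GeneralLinearGroup (Fin n) ℂ) V) : Prop :=
  ∀ (l : V →ₗ[ℂ] ℂ) (v : V), ∃ (P : MvPolynomial (Fin n × Fin n) ℂ) (k : ℕ),
    ∀ g : Matrix.GeneralLinearGroup (Fin n) ℂ,
      l (ρ g v) = MvPolynomial.eval (fun ij => (g : Matrix (Fin n) (Fin n) ℂ) ij.1 ij.2) P *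
        ((g : Matrix (Fin n) (Fin n) ℂ).det ^ k)⁻¹

/-- `lam` is the highest weight of `ρ` (for irreducible `ρ`): some non-zero vector `v` satisfies
`ρ(b) v = (∏ i, b_{ii} ^ lam_i) v` for all invertible upper triangular matrices `b`. -/
def IsHighestWeight (ρ : Representation ℂ (Matrix.GeneralLinearGroup (Fin n) ℂ) V)
    (lam : Fin n → ℤ) : Prop :=
  ∃ v : V, v ≠ 0 ∧ ∀ b : Matrix.GeneralLinearGroup (Fin n) ℂ,
    (∀ i j, j < i → (b : Matrix (Fin n) (Fin n) ℂ) i j = 0) →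
      ρ b v = (∏ i, (b : Matrix (Fin n) (Fin n) ℂ) i i ^ lam i) • v

/-! ### Nearly holomorphic Siegel modular forms -/

/-- `Sp_{2n}(ℤ)` as a subgroup of `Sp_{2n}(ℚ)`. -/
def spInt (n : ℕ) : Subgroup (Sp n ℚ) := (spMap (n := n) (Int.castRingHom ℚ)).range

/-- The principal congruence subgroup of level `N` of `Sp_{2n}(ℤ)`, as a subgroup of
`Sp_{2n}(ℚ)`. -/
def principalCongruence (n N : ℕ) : Subgroup (Sp n ℚ) :=
  (spMap (n := n) (Int.castRingHom (ZMod N))).ker.map (spMap (Int.castRingHom ℚ))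

/-- A congruence subgroup of `Sp_{2n}(ℚ)`: a subgroup commensurable with `Sp_{2n}(ℤ)` that contains
some principal congruence subgroup. -/
def IsCongruenceSubgroup (Γ : Subgroup (Sp n ℚ)) : Prop :=
  Γ.Commensurable (spInt n) ∧ ∃ N : ℕ, 0 < N ∧ principalCongruence n N ≤ Γ

/-- The inclusion `Sp_{2n}(ℚ) → Sp_{2n}(ℝ)`. -/
noncomputable def spRatToReal : Sp n ℚ →* Sp n ℝ := spMap (algebraMap ℚ ℝ)

/-- `(F|_ρ g)(Z) = ρ(J(g, Z))⁻¹ F(gZ)`. -/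
noncomputable def slash (ρ : Representation ℂ (Matrix.GeneralLinearGroup (Fin n) ℂ) V)
    (F : SiegelUpperHalfSpace n → V) (g : Sp n ℝ) : SiegelUpperHalfSpace n → V :=
  fun Z => ρ (autFactor g Z)⁻¹ (F (act g Z))

/-- `F ∈ N_ρ^p(Γ)`. -/
structure IsNearlyHolomorphicFormOn
    (ρ : Representation ℂ (Matrix.GeneralLinearGroup (Fin n) ℂ) V) (p : ℕ)
    (Γ : Subgroup (Sp n ℚ)) (F : SiegelUpperHalfSpace n → V) : Prop where
  nearlyHolomorphic : ∀ (g : Sp n ℚ) (l : V →ₗ[ℂ] ℂ),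
    IsNearlyHolomorphic p (fun Z => l (slash ρ F (spRatToReal g) Z))
  niceFourierExpansion : ∀ (g : Sp n ℚ) (l : V →ₗ[ℂ] ℂ),
    HasNiceFourierExpansion p (fun Z => l (slash ρ F (spRatToReal g) Z))
  transformation : ∀ γ ∈ Γ, slash ρ F (spRatToReal γ) = F

/-- `F ∈ N_ρ^{(n)}`: `F` is a nearly holomorphic Siegel modular form of weight `ρ`, that is,
`F ∈ N_ρ^p(Γ)` for some `p` and some congruence subgroup `Γ`. -/
def IsNearlyHolomorphicForm (ρ : Representation ℂ (Matrix.GeneralLinearGroup (Fin n) ℂ) V)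
    (F : SiegelUpperHalfSpace n → V) : Prop :=
  ∃ (Γ : Subgroup (Sp n ℚ)) (p : ℕ), IsCongruenceSubgroup Γ ∧ IsNearlyHolomorphicFormOn ρ p Γ F

/-- The lift `g ↦ ρ(J(g, i))⁻¹ F(g i)` of `F` to `Sp_{2n}(ℝ)`, where `i` is the base point. -/
noncomputable def vecLift (ρ : Representation ℂ (Matrix.GeneralLinearGroup (Fin n) ℂ) V)
    (F : SiegelUpperHalfSpace n → V) (g : Sp n ℝ) : V :=
  ρ (autFactor g (basePoint n))⁻¹ (F (act g (basePoint n)))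

end Representations

/-! ### Moderate growth -/

/-- `Tr(g* g)`. -/
noncomputable def traceNorm (g : Sp n ℝ) : ℝ :=
  ((g : Matrix (Fin n ⊕ Fin n) (Fin n ⊕ Fin n) ℝ)ᴴ *
    (g : Matrix (Fin n ⊕ Fin n) (Fin n ⊕ Fin n) ℝ)).trace

/-- `Φ : Sp_{2n}(ℝ) → ℂ` has moderate growth (is slowly increasing): there are a constant `C` and a
positive integer `r` with `|Φ(g)| ≤ C Tr(g* g)^r` for all `g`. -/
def HasModerateGrowth (Φ : Sp n ℝ → ℂ) : Prop :=
  ∃ (C : ℝ) (r : ℕ), 0 < r ∧ ∀ g, ‖Φ g‖ ≤ C * traceNorm g ^ r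

end SiegelForms

/-! The size of `ρ(J(g,i))⁻¹ F(gi)` is controlled by moving `g` with some `γ ∈ Sp_{2n}(ℤ)` to a
reduced element `g' = γg`. Then the lift at `g` equals `ρ(J(g',i))⁻¹ (F|γ⁻¹)(g'i)`, and its two
factors are estimated separately.

Reduction (`exists_reduced_denom`): read in `ℂⁿ`, the rows of `g` span a lattice on which the
imaginary part of the Hermitian form is the standard symplectic form. An induction on `n` by
projecting away from a nearly shortest vector (`IsSymplecticSystem.exists_reduced`) gives a
symplectic basis whose Lagrangian half is bounded in terms of `n`. That half consists of the rows of
`J(g',i)`.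

The form: `Im(g'i)⁻¹ = CCᵀ + DDᵀ` is then bounded, so every Fourier term of `F|γ⁻¹` at `g'i` is
dominated by its value at one fixed point (`HasNiceFourierExpansion.exists_bound`). Only finitely
many functions `F|γ⁻¹` occur, as `F` is invariant under a subgroup meeting `Sp_{2n}(ℤ)` in finite
index.

The representation: `det(B)^{λ₁} ρ(B)⁻¹` has bounded matrix coefficients for bounded `B`
(`exists_bound_inv_mul_det`). On a highest weight vector this follows from the QR decomposition, and
irreducibility extends it to all vectors.

Together the lift is `O(|det J(g',i)|^{-λ₁})`. Finally `|det J(γg,i)|² = det(R ggᵀ Rᵀ)` with `R` the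
lower rows of `γ`. Since `ggᵀ ≥ Tr(g*g)⁻¹` and `det(RRᵀ)` is a positive integer, this is at least
`Tr(g*g)^{-n}` (`one_le_traceNorm_pow_mul_norm_det_sq`), whence the exponent `nλ₁/2`. -/

/-! ### Reduction theory of symplectic lattices in a Hermitian space -/

/-- Vectors `e i`, `f i` of a complex inner product space that form a symplectic system for the
imaginary part of the inner product. -/
structure IsSymplecticSystem {E : Type*} [NormedAddCommGroup E] [InnerProductSpace ℂ E] {ι : Type*}
    [DecidableEq ι] (e f : ι → E) : Prop where
  im_left : ∀ i j, (inner ℂ (e i) (e j)).im = 0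
  im_right : ∀ i j, (inner ℂ (f i) (f j)).im = 0
  im_pair : ∀ i j, (inner ℂ (e i) (f j)).im = if i = j then 1 else 0

/-- The lattice generated by a system of vectors. -/
def systemSpan {E : Type*} [AddCommGroup E] {ι : Type*} (e f : ι → E) : AddSubgroup E :=
  AddSubgroup.closure (Set.range e ∪ Set.range f)

theorem left_mem_systemSpan {E : Type*} [AddCommGroup E] {ι : Type*} (e f : ι → E) (i : ι) :
    e i ∈ systemSpan e f :=
  AddSubgroup.subset_closure (Or.inl ⟨i, rfl⟩)

theorem right_mem_systemSpan {E : Type*} [AddCommGroup E] {ι : Type*} (e f : ι → E) (i : ι) :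
    f i ∈ systemSpan e f :=
  AddSubgroup.subset_closure (Or.inr ⟨i, rfl⟩)

section Lattice

variable {E : Type*} [NormedAddCommGroup E] [InnerProductSpace ℂ E]

theorem im_inner_swap (x y : E) : (inner ℂ x y).im = -(inner ℂ y x).im := by
  rw [← inner_conj_symm x y, Complex.conj_im]

theorem im_inner_self (x : E) : (inner ℂ x x).im = 0 := by
  linarith [im_inner_swap x x]

theorem IsSymplecticSystem.im_pair' {ι : Type*} [DecidableEq ι] {e f : ι → E}
    (h : IsSymplecticSystem e f) (i j : ι) :
    (inner ℂ (f i) (e j)).im = if i = j then -1 else 0 := by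
  rw [im_inner_swap, h.im_pair]
  by_cases hij : i = j
  · simp [hij]
  · simp [hij, Ne.symm hij]

theorem im_inner_eq_zero_of_mem_systemSpan {ι : Type*} {e f : ι → E} {x : E}
    (he : ∀ i, (inner ℂ x (e i)).im = 0) (hf : ∀ i, (inner ℂ x (f i)).im = 0) {y : E}
    (hy : y ∈ systemSpan e f) : (inner ℂ x y).im = 0 := by
  induction hy using AddSubgroup.closure_induction with
  | mem y hy =>
    rcases hy with ⟨i, rfl⟩ | ⟨i, rfl⟩
    exacts [he i, hf i]
  | zero => simp
  | add a b _ _ ha hb => simp [ha, hb]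
  | neg a _ ha => simp [ha]

theorem im_inner_int_of_mem_systemSpan {ι : Type*} {e f : ι → E} {x : E}
    (he : ∀ i, ∃ m : ℤ, (inner ℂ x (e i)).im = m) (hf : ∀ i, ∃ m : ℤ, (inner ℂ x (f i)).im = m)
    {y : E} (hy : y ∈ systemSpan e f) : ∃ m : ℤ, (inner ℂ x y).im = m := by
  induction hy using AddSubgroup.closure_induction with
  | mem y hy =>
    rcases hy with ⟨i, rfl⟩ | ⟨i, rfl⟩
    exacts [he i, hf i]
  | zero => exact ⟨0, by simp⟩
  | add a b _ _ ha hb =>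
    obtain ⟨k, hk⟩ := ha
    obtain ⟨l, hl⟩ := hb
    exact ⟨k + l, by simp [hk, hl]⟩
  | neg a _ ha =>
    obtain ⟨k, hk⟩ := ha
    exact ⟨-k, by simp [hk]⟩

/-- Generators pair to `0` or `±1`, and the pairing is biadditive. Integrality serves as a gap: a
non-zero pairing has absolute value at least `1`, which prevents short vectors. -/
theorem IsSymplecticSystem.im_inner_int {ι : Type*} [DecidableEq ι] {e f : ι → E}
    (h : IsSymplecticSystem e f) {x y : E} (hx : x ∈ systemSpan e f) (hy : y ∈ systemSpan e f) :
    ∃ m : ℤ, (inner ℂ x y).im = m := by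
  have key (z : E) (hz : (∃ i, z = e i) ∨ ∃ i, z = f i) : ∃ m : ℤ, (inner ℂ x z).im = m := by
    have : ∃ m : ℤ, (inner ℂ z x).im = m := by
      rcases hz with ⟨i, rfl⟩ | ⟨i, rfl⟩
      · refine im_inner_int_of_mem_systemSpan (fun j => ⟨0, ?_⟩)
          (fun j => ⟨if i = j then 1 else 0, ?_⟩) hx
        · simp [h.im_left]
        · rw [h.im_pair]; split_ifs <;> simp
      · refine im_inner_int_of_mem_systemSpan (fun j => ⟨if i = j then -1 else 0, ?_⟩)
          (fun j => ⟨0, ?_⟩) hx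
        · rw [h.im_pair']; split_ifs <;> simp
        · simp [h.im_right]
    obtain ⟨m, hm⟩ := this
    exact ⟨-m, by rw [im_inner_swap, hm]; simp⟩
  exact im_inner_int_of_mem_systemSpan (fun i => key _ (Or.inl ⟨i, rfl⟩))
    (fun i => key _ (Or.inr ⟨i, rfl⟩)) hy

/-- A vector of the lattice that pairs non-trivially with some other vector of it is not short. -/
theorem IsSymplecticSystem.exists_norm_lower_bound {ι : Type*} [Fintype ι] [DecidableEq ι]
    {e f : ι → E} (h : IsSymplecticSystem e f) : ∃ δ : ℝ, 0 < δ ∧ ∀ x ∈ systemSpan e f,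
      ∀ y ∈ systemSpan e f, (inner ℂ x y).im ≠ 0 → δ ≤ ‖x‖ ^ 2 := by
  -- `M` dominates every generator; the summand `1` keeps it positive for empty `ι`. If `x` pairs
  -- non-trivially with a generator `z`, then `1 ≤ ‖x‖ ‖z‖ ≤ ‖x‖ M`.
  set M : ℝ := 1 + ∑ i, ‖e i‖ + ∑ i, ‖f i‖ with hM
  have he (i : ι) : ‖e i‖ ≤ M := by
    have h1 := Finset.single_le_sum (f := fun i => ‖e i‖) (fun i _ => norm_nonneg _)
      (Finset.mem_univ i)
    have h2 : 0 ≤ ∑ i, ‖f i‖ := Finset.sum_nonneg fun i _ => norm_nonneg _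
    linarith
  have hf (i : ι) : ‖f i‖ ≤ M := by
    have h1 := Finset.single_le_sum (f := fun i => ‖f i‖) (fun i _ => norm_nonneg _)
      (Finset.mem_univ i)
    have h2 : 0 ≤ ∑ i, ‖e i‖ := Finset.sum_nonneg fun i _ => norm_nonneg _
    linarith
  have hM0 : 0 < M := by
    have h1 : 0 ≤ ∑ i, ‖f i‖ := Finset.sum_nonneg fun i _ => norm_nonneg _
    have h2 : 0 ≤ ∑ i, ‖e i‖ := Finset.sum_nonneg fun i _ => norm_nonneg _
    linarith
  refine ⟨(1 / M) ^ 2, by positivity, fun x hx y hy hxy => ?_⟩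
  have bound (z : E) (hz : z ∈ systemSpan e f) (hzM : ‖z‖ ≤ M) (h0 : (inner ℂ x z).im ≠ 0) :
      (1 / M) ^ 2 ≤ ‖x‖ ^ 2 := by
    obtain ⟨m, hm⟩ := h.im_inner_int hx hz
    have hm0 : m ≠ 0 := by
      rintro rfl
      exact h0 (by simpa using hm)
    have h1 : (1 : ℝ) ≤ |(m : ℝ)| := by exact_mod_cast Int.one_le_abs hm0
    have h2 : |(m : ℝ)| ≤ ‖x‖ * ‖z‖ := by
      rw [← hm]
      exact (Complex.abs_im_le_norm _).trans (norm_inner_le_norm x z)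
    have h3 : ‖x‖ * ‖z‖ ≤ ‖x‖ * M := by gcongr
    have h4 : 1 / M ≤ ‖x‖ := by
      rw [div_le_iff₀ hM0]
      linarith
    gcongr
  by_contra hlt
  refine hxy (im_inner_eq_zero_of_mem_systemSpan (fun i => ?_) (fun i => ?_) hy)
  · by_contra h0
    exact hlt (bound _ (left_mem_systemSpan e f i) (he i) h0)
  · by_contra h0
    exact hlt (bound _ (right_mem_systemSpan e f i) (hf i) h0)

/-- The orthogonal projection onto the complement of a vector. -/
noncomputable def projCompl (u : E) : E →L[ℂ] (ℂ ∙ u)ᗮ := (ℂ ∙ u)ᗮ.orthogonalProjectionOnto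

theorem projCompl_coe (u x : E) :
    (projCompl u x : E) = x - (inner ℂ u x / (‖u‖ ^ 2 : ℝ) : ℂ) • u := by
  rw [projCompl, ← Submodule.starProjection_apply, Submodule.starProjection_orthogonal_val,
    Submodule.starProjection_singleton]
  simp

theorem inner_projCompl {u : E} (hu : u ≠ 0) (x y : E) :
    inner ℂ (projCompl u x) (projCompl u y) =
      inner ℂ x y - inner ℂ x u * inner ℂ u y / (‖u‖ ^ 2 : ℝ) := by
  have h0 : ((‖u‖ ^ 2 : ℝ) : ℂ) ≠ 0 := by
    norm_cast
    exact pow_ne_zero 2 (norm_ne_zero_iff.mpr hu)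
  have huu : inner ℂ u u = ((‖u‖ ^ 2 : ℝ) : ℂ) := by
    rw [inner_self_eq_norm_sq_to_K]; simp
  rw [Submodule.coe_inner, projCompl_coe, projCompl_coe]
  simp only [inner_sub_left, inner_sub_right, inner_smul_left, inner_smul_right, huu, map_div₀,
    inner_conj_symm, Complex.conj_ofReal]
  field_simp
  ring

/-- The correction term in `inner_projCompl` is a quotient of real numbers here. Thus orthogonal
projection realises symplectic reduction along `u` inside a Hermitian space of one dimension less,
which is what makes the induction on `n` possible. -/
theorem im_inner_projCompl {u : E} (hu : u ≠ 0) {x y : E} (hx : (inner ℂ u x).im = 0)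
    (hy : (inner ℂ u y).im = 0) :
    (inner ℂ (projCompl u x) (projCompl u y)).im = (inner ℂ x y).im := by
  have hx' : (inner ℂ x u).im = 0 := by rw [im_inner_swap, hx, neg_zero]
  rw [inner_projCompl hu, Complex.sub_im, Complex.div_ofReal_im, Complex.mul_im, hx', hy]
  simp

/-- Shifting a vector by a suitable integral multiple of `u` makes its component along `u` small. -/
theorem exists_int_norm_sq_add_smul_le {u : E} (hu : u ≠ 0) (x : E) :
    ∃ m : ℤ, ‖x + m • u‖ ^ 2 ≤
      ‖projCompl u x‖ ^ 2 + ‖u‖ ^ 2 / 4 + (inner ℂ u x).im ^ 2 / ‖u‖ ^ 2 := by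
  have h0 : 0 < ‖u‖ ^ 2 := by positivity
  set t := (inner ℂ u x).re / ‖u‖ ^ 2 with ht
  -- Integral multiples of `u` move only the real part of the coefficient along `u`, which rounding
  -- brings to at most `1/2`. The imaginary part is untouched and accounts for the last term of the
  -- bound.
  refine ⟨-round t, ?_⟩
  set m : ℤ := -round t with hm
  have hround : (t + m) ^ 2 ≤ 1 / 4 := by
    have := abs_sub_round t
    have h1 : |t + m| ≤ 1 / 2 := by simpa [hm, ← sub_eq_add_neg] using this
    rw [← sq_abs]
    nlinarith [abs_nonneg (t + m)]
  have hre : (inner ℂ u x).re = t * ‖u‖ ^ 2 := by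
    rw [ht]; field_simp
  have hu2 : ‖u‖ ^ 2 = (inner ℂ u u).re := by
    rw [inner_self_eq_norm_sq_to_K]; norm_cast
  have key : ‖x + m • u‖ ^ 2 = ‖projCompl u x‖ ^ 2 + (t + m) ^ 2 * ‖u‖ ^ 2
      + (inner ℂ u x).im ^ 2 / ‖u‖ ^ 2 := by
    have h1 : ‖projCompl u x‖ ^ 2 = ‖x‖ ^ 2 - ((inner ℂ u x).re ^ 2 + (inner ℂ u x).im ^ 2)
        / ‖u‖ ^ 2 := by
      have h2 := congrArg Complex.re (inner_projCompl hu x x)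
      rw [inner_self_eq_norm_sq_to_K, inner_self_eq_norm_sq_to_K, ← inner_conj_symm x u,
        ← Complex.normSq_eq_conj_mul_self, Complex.sub_re, Complex.div_ofReal_re,
        Complex.ofReal_re, Complex.normSq_apply] at h2
      have h5 (r : ℝ) : (((r : ℂ)) ^ 2).re = r ^ 2 := by norm_cast
      simp only [Complex.coe_algebraMap, h5] at h2
      rw [h2]
      ring
    have h3 : ‖x + m • u‖ ^ 2 = ‖x‖ ^ 2 + 2 * m * (inner ℂ u x).re + m ^ 2 * ‖u‖ ^ 2 := by
      have h4 : (m • u : E) = (m : ℂ) • u := (Int.cast_smul_eq_zsmul ℂ m u).symm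
      have h5 : (inner ℂ x u).re = (inner ℂ u x).re := by
        rw [← inner_conj_symm x u, Complex.conj_re]
      rw [h4, norm_add_sq (𝕜 := ℂ), inner_smul_right, norm_smul]
      simp [mul_pow, h5]
      ring
    rw [h1, h3, hre]
    field_simp
    ring
  rw [key]
  nlinarith

end Lattice

theorem systemSpan_le {E : Type*} [AddCommGroup E] {ι κ : Type*} {e f : ι → E} {a b : κ → E}
    (ha : ∀ i, a i ∈ systemSpan e f) (hb : ∀ i, b i ∈ systemSpan e f) :
    systemSpan a b ≤ systemSpan e f := by
  rw [systemSpan, AddSubgroup.closure_le]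
  rintro x (⟨i, rfl⟩ | ⟨i, rfl⟩)
  exacts [ha i, hb i]

section Lattice

variable {E : Type*} [NormedAddCommGroup E] [InnerProductSpace ℂ E]

theorem exists_lift_of_mem_systemSpan_projCompl {ι : Type*} {e f : ι → E} (u : E)
    {x : (ℂ ∙ u)ᗮ}
    (hx : x ∈ systemSpan (fun i => projCompl u (e i)) (fun i => projCompl u (f i))) :
    ∃ y ∈ systemSpan e f, projCompl u y = x := by
  have h : systemSpan (fun i => projCompl u (e i)) (fun i => projCompl u (f i)) =
      (systemSpan e f).map (projCompl u : E →+ (ℂ ∙ u)ᗮ) := by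
    rw [systemSpan, systemSpan, AddMonoidHom.map_closure, Set.image_union, ← Set.range_comp,
      ← Set.range_comp]
    rfl
  rw [h] at hx
  exact hx

theorem IsSymplecticSystem.ne_zero {ι : Type*} [DecidableEq ι] {e f : ι → E}
    (h : IsSymplecticSystem e f) (i : ι) : e i ≠ 0 := by
  intro h0
  have := h.im_pair i i
  simp [h0] at this

theorem IsSymplecticSystem.map_projCompl {n : ℕ} {e f : Fin (n + 1) → E}
    (h : IsSymplecticSystem e f) :
    IsSymplecticSystem (fun i : Fin n => projCompl (e 0) (e i.succ))
      (fun i : Fin n => projCompl (e 0) (f i.succ)) where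
  im_left i j := by
    rw [im_inner_projCompl (h.ne_zero 0) (h.im_left _ _) (h.im_left _ _), h.im_left]
  im_right i j := by
    rw [im_inner_projCompl (h.ne_zero 0) (by simp [h.im_pair, (Fin.succ_ne_zero _).symm])
      (by simp [h.im_pair, (Fin.succ_ne_zero _).symm]), h.im_right]
  im_pair i j := by
    rw [im_inner_projCompl (h.ne_zero 0) (h.im_left _ _)
      (by simp [h.im_pair, (Fin.succ_ne_zero _).symm]), h.im_pair]
    simp

/-- A symplectic system of the projected lattice lifts to a symplectic system containing `e 0`,
whose other vectors have been size-reduced with respect to `e 0`. -/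
theorem IsSymplecticSystem.exists_lift {n : ℕ} {e f : Fin (n + 1) → E}
    (h : IsSymplecticSystem e f) {e' f' : Fin n → (ℂ ∙ e 0)ᗮ} (h' : IsSymplecticSystem e' f')
    (he' : ∀ i, e' i ∈ systemSpan (fun i : Fin n => projCompl (e 0) (e i.succ))
      (fun i : Fin n => projCompl (e 0) (f i.succ)))
    (hf' : ∀ i, f' i ∈ systemSpan (fun i : Fin n => projCompl (e 0) (e i.succ))
      (fun i : Fin n => projCompl (e 0) (f i.succ))) :
    ∃ a b : Fin (n + 1) → E, IsSymplecticSystem a b ∧ (∀ i, a i ∈ systemSpan e f) ∧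
      (∀ i, b i ∈ systemSpan e f) ∧ a 0 = e 0 ∧
      ∀ i : Fin n, ‖a i.succ‖ ^ 2 ≤ ‖e' i‖ ^ 2 + ‖e 0‖ ^ 2 / 4 := by
  have hu := h.ne_zero 0
  choose x hx hxe using fun i => exists_lift_of_mem_systemSpan_projCompl (e 0) (he' i)
  choose y hy hyf using fun i => exists_lift_of_mem_systemSpan_projCompl (e 0) (hf' i)
  -- The lifts are chosen in the span of the remaining basis vectors, so they pair to zero with both
  -- `e 0` and `f 0`, and by `im_inner_projCompl` they keep the pairings of their projections.
  have e0 {z : E} (hz : z ∈ systemSpan (fun i : Fin n => e i.succ) (fun i : Fin n => f i.succ)) :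
      (inner ℂ (e 0) z).im = 0 :=
    im_inner_eq_zero_of_mem_systemSpan (fun i => h.im_left _ _)
      (fun i => by simp [h.im_pair, (Fin.succ_ne_zero _).symm]) hz
  have f0 {z : E} (hz : z ∈ systemSpan (fun i : Fin n => e i.succ) (fun i : Fin n => f i.succ)) :
      (inner ℂ (f 0) z).im = 0 :=
    im_inner_eq_zero_of_mem_systemSpan (fun i => by simp [h.im_pair', (Fin.succ_ne_zero _).symm])
      (fun i => h.im_right _ _) hz
  have e0' {z : E} (hz : z ∈ systemSpan (fun i : Fin n => e i.succ) (fun i : Fin n => f i.succ)) :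
      (inner ℂ z (e 0)).im = 0 := by rw [im_inner_swap, e0 hz, neg_zero]
  have f0' {z : E} (hz : z ∈ systemSpan (fun i : Fin n => e i.succ) (fun i : Fin n => f i.succ)) :
      (inner ℂ z (f 0)).im = 0 := by rw [im_inner_swap, f0 hz, neg_zero]
  have hle : systemSpan (fun i : Fin n => e i.succ) (fun i : Fin n => f i.succ) ≤
      systemSpan e f :=
    systemSpan_le (fun i => left_mem_systemSpan e f _) (fun i => right_mem_systemSpan e f _)
  choose m hm using fun i => exists_int_norm_sq_add_smul_le hu (x i)
  have hxx (i j) : (inner ℂ (x i) (x j)).im = 0 := by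
    rw [← im_inner_projCompl hu (e0 (hx i)) (e0 (hx j)), hxe, hxe, h'.im_left]
  have hyy (i j) : (inner ℂ (y i) (y j)).im = 0 := by
    rw [← im_inner_projCompl hu (e0 (hy i)) (e0 (hy j)), hyf, hyf, h'.im_right]
  have hxy (i j) : (inner ℂ (x i) (y j)).im = if i = j then 1 else 0 := by
    rw [← im_inner_projCompl hu (e0 (hx i)) (e0 (hy j)), hxe, hyf, h'.im_pair]
  have e00 : (inner ℂ (e 0) (e 0)).im = 0 := h.im_left _ _
  have f00 : (inner ℂ (f 0) (f 0)).im = 0 := h.im_right _ _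
  have ef0 : (inner ℂ (e 0) (f 0)).im = 1 := by simp [h.im_pair]
  have smulL (k : ℤ) (v w : E) : (inner ℂ (k • v) w).im = k * (inner ℂ v w).im := by
    rw [← Int.cast_smul_eq_zsmul ℂ k v, inner_smul_left]; simp
  have smulR (k : ℤ) (v w : E) : (inner ℂ v (k • w)).im = k * (inner ℂ v w).im := by
    rw [← Int.cast_smul_eq_zsmul ℂ k w, inner_smul_right]; simp
  -- Replacing `x i` by `x i + m i • e 0` creates the pairing `m i` with `f 0`. As `x i` pairs to `m
  -- i` with `s`, replacing `f 0` by `f 0 - s` cancels it.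
  set s : E := ∑ j, m j • y j with hs
  have hsmem : s ∈ systemSpan (fun i : Fin n => e i.succ) (fun i : Fin n => f i.succ) :=
    AddSubgroup.sum_mem _ fun j _ => AddSubgroup.zsmul_mem _ (hy j) _
  have hsy (j) : (inner ℂ s (y j)).im = 0 := by
    rw [hs, sum_inner, Complex.im_sum]
    exact Finset.sum_eq_zero fun i _ => by rw [smulL, hyy, mul_zero]
  have hys (j) : (inner ℂ (y j) s).im = 0 := by rw [im_inner_swap, hsy, neg_zero]
  have hss : (inner ℂ s s).im = 0 := im_inner_self s
  have hxs (i) : (inner ℂ (x i) s).im = m i := by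
    rw [hs, inner_sum, Complex.im_sum]
    simp [smulR, hxy]
  refine ⟨Fin.cons (e 0) fun i => x i + m i • e 0, Fin.cons (f 0 - s) y, ⟨?_, ?_, ?_⟩, ?_, ?_,
    rfl, fun i => ?_⟩
  · intro i j
    refine Fin.cases ?_ (fun i => ?_) i <;> refine Fin.cases ?_ (fun j => ?_) j <;>
      simp only [Fin.cons_zero, Fin.cons_succ, inner_add_left, inner_add_right, Complex.add_im,
        smulL, smulR, e00, e0 (hx _), e0' (hx _), hxx] <;> simp
  · intro i j
    refine Fin.cases ?_ (fun i => ?_) i <;> refine Fin.cases ?_ (fun j => ?_) j <;>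
      simp only [Fin.cons_zero, Fin.cons_succ, inner_sub_left, inner_sub_right, Complex.sub_im,
        f00, f0 (hy _), f0' (hy _), f0 hsmem, f0' hsmem, hss, hsy, hys, hyy] <;> simp
  · intro i j
    refine Fin.cases ?_ (fun i => ?_) i <;> refine Fin.cases ?_ (fun j => ?_) j <;>
      simp only [Fin.cons_zero, Fin.cons_succ, inner_sub_right, inner_add_left, Complex.sub_im,
        Complex.add_im, smulL, ef0, e0 (hy _), e0 hsmem, f0' (hx _), hxs, hxy] <;>
      simp [Fin.succ_ne_zero, (Fin.succ_ne_zero _).symm]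
  · intro i
    refine Fin.cases ?_ (fun i => ?_) i
    · exact left_mem_systemSpan e f 0
    · exact add_mem (hle (hx i)) (AddSubgroup.zsmul_mem _ (left_mem_systemSpan e f 0) _)
  · intro i
    refine Fin.cases ?_ (fun i => ?_) i
    · exact sub_mem (right_mem_systemSpan e f 0) (hle hsmem)
    · exact hle (hy i)
  · have := hm i
    rw [hxe, e0 (hx i)] at this
    simpa using this

/-- Among the symplectic systems of a lattice there is one whose first vector is shortest up to a
factor `2`. -/
theorem IsSymplecticSystem.exists_nearly_minimal {n : ℕ} {e f : Fin (n + 1) → E}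
    (h : IsSymplecticSystem e f) :
    ∃ a b : Fin (n + 1) → E, IsSymplecticSystem a b ∧ (∀ i, a i ∈ systemSpan e f) ∧
      (∀ i, b i ∈ systemSpan e f) ∧ ∀ c d : Fin (n + 1) → E, IsSymplecticSystem c d →
        (∀ i, c i ∈ systemSpan e f) → (∀ i, d i ∈ systemSpan e f) →
        ‖a 0‖ ^ 2 ≤ 2 * ‖c 0‖ ^ 2 := by
  obtain ⟨δ, hδ, hδ'⟩ := h.exists_norm_lower_bound
  set S : Set ℝ := {t | ∃ a b : Fin (n + 1) → E, IsSymplecticSystem a b ∧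
    (∀ i, a i ∈ systemSpan e f) ∧ (∀ i, b i ∈ systemSpan e f) ∧ t = ‖a 0‖ ^ 2} with hS
  have hne : S.Nonempty := ⟨_, e, f, h, left_mem_systemSpan e f, right_mem_systemSpan e f, rfl⟩
  have hlb : ∀ t ∈ S, δ ≤ t := by
    rintro _ ⟨a, b, hab, ha, hb, rfl⟩
    exact hδ' _ (ha 0) _ (hb 0) (by simp [hab.im_pair])
  have hpos : 0 < sInf S := hδ.trans_le (le_csInf hne hlb)
  -- The factor `2` avoids having to show that the infimum is attained; it works because the infimum
  -- is positive.
  obtain ⟨_, ⟨a, b, hab, ha, hb, rfl⟩, hlt⟩ :=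
    exists_lt_of_csInf_lt hne (show sInf S < 2 * sInf S by linarith)
  refine ⟨a, b, hab, ha, hb, fun c d hcd hc hd => ?_⟩
  have : sInf S ≤ ‖c 0‖ ^ 2 := csInf_le ⟨δ, hlb⟩ ⟨c, d, hcd, hc, hd, rfl⟩
  linarith

theorem IsSymplecticSystem.comp_equiv {ι κ : Type*} [DecidableEq ι] [DecidableEq κ] {e f : ι → E}
    (h : IsSymplecticSystem e f) (σ : κ ≃ ι) : IsSymplecticSystem (e ∘ σ) (f ∘ σ) where
  im_left i j := h.im_left _ _
  im_right i j := h.im_right _ _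
  im_pair i j := by simp [h.im_pair]

end Lattice

/-- A bound, depending only on `n`, for the reduced symplectic systems of rank `2n`. -/
def reductionConst : ℕ → ℝ
  | 0 => 0
  -- With `c` the constant for rank `n`: for `n ≥ 1` the first vector satisfies `‖e 0‖² ≤ 2(c + ‖e
  -- 0‖²/4)`, so `‖e 0‖² ≤ 4c`; for `n = 0` one gets `‖e 0‖² ≤ 2`. The other vectors have square
  -- norm at most `c + (4c + 2)/4`.
  | n + 1 => 4 * reductionConst n + 2

theorem reductionConst_nonneg (n : ℕ) : 0 ≤ reductionConst n := by
  induction n with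
  | zero => exact le_rfl
  | succ n ih => rw [reductionConst]; positivity

/-- Reduction theory: the lattice spanned by a symplectic system in an `n`-dimensional Hermitian
space contains a symplectic system whose Lagrangian half is bounded in terms of `n`. -/
theorem IsSymplecticSystem.exists_reduced (n : ℕ) :
    ∀ {E : Type} [NormedAddCommGroup E] [InnerProductSpace ℂ E] [FiniteDimensional ℂ E],
      Module.finrank ℂ E = n → ∀ {e f : Fin n → E}, IsSymplecticSystem e f →
      ∃ a b : Fin n → E, IsSymplecticSystem a b ∧ (∀ i, a i ∈ systemSpan e f) ∧
        (∀ i, b i ∈ systemSpan e f) ∧ ∀ i, ‖a i‖ ^ 2 ≤ reductionConst n := by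
  induction n with
  | zero =>
    intro E _ _ _ _ e f h
    exact ⟨e, f, h, fun i => i.elim0, fun i => i.elim0, fun i => i.elim0⟩
  | succ n ih =>
    intro E _ _ _ hE e₁ f₁ h₁
    obtain ⟨e, f, h, he, hf, hmin⟩ := h₁.exists_nearly_minimal
    have hle := systemSpan_le he hf
    have hu := h.ne_zero 0
    have hK : Module.finrank ℂ (ℂ ∙ e 0)ᗮ = n :=
      haveI : Fact (Module.finrank ℂ E = n + 1) := ⟨hE⟩
      Submodule.finrank_orthogonal_span_singleton hu
    obtain ⟨e', f', h', he', hf', hb'⟩ := ih hK h.map_projCompl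
    obtain ⟨a, b, hab, ha, hb, ha0, hsucc⟩ := h.exists_lift h' he' hf'
    refine ⟨a, b, hab, fun i => hle (ha i), fun i => hle (hb i), ?_⟩
    have hC := reductionConst_nonneg n
    have h0 : ‖e 0‖ ^ 2 ≤ 4 * reductionConst n + 2 := by
      cases n with
      | zero =>
        have hpos : 0 < ‖e 0‖ ^ 2 := by positivity
        obtain ⟨m, hm⟩ := exists_int_norm_sq_add_smul_le hu (f 0)
        have hz : projCompl (e 0) (f 0) = 0 :=
          haveI := Module.finrank_zero_iff.mp hK
          Subsingleton.elim _ _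
        have hf0 : (inner ℂ (e 0) (f 0)).im = 1 := by simp [h.im_pair]
        rw [hz, hf0] at hm
        -- In dimension one the competitor comes from exchanging `e` and `f`, as in the reduction of
        -- binary forms. With `t = ‖e 0‖²`, near-minimality gives `t ≤ t/2 + 2/t`, hence `t ≤ 2`.
        have hsw : IsSymplecticSystem (fun _ : Fin 1 => f 0 + m • e 0) (fun _ : Fin 1 => -e 0) := by
          refine ⟨fun i j => ?_, fun i j => ?_, fun i j => ?_⟩
          · exact im_inner_self _
          · exact im_inner_self _
          · rw [Subsingleton.elim i j, if_pos rfl, inner_neg_right, inner_add_left,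
              ← Int.cast_smul_eq_zsmul ℂ m (e 0), inner_smul_left, Complex.neg_im, Complex.add_im,
              im_inner_swap, hf0, Complex.mul_im, im_inner_self]
            simp
        have h2 := hmin _ _ hsw
          (fun i => add_mem (hf 0) (AddSubgroup.zsmul_mem _ (he 0) _))
          (fun i => neg_mem (he 0))
        have h3 : ‖e 0‖ ^ 2 ≤ 2 * (‖e 0‖ ^ 2 / 4 + 1 / ‖e 0‖ ^ 2) := by
          refine h2.trans ?_
          simpa using hm
        have h4 : ‖e 0‖ ^ 2 * (1 / ‖e 0‖ ^ 2) = 1 := by field_simp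
        simp only [reductionConst]
        by_contra! hlt
        have h5 : 1 / ‖e 0‖ ^ 2 < 1 / 2 := by
          apply one_div_lt_one_div_of_lt <;> linarith
        linarith
      | succ n =>
        -- In higher rank the competitor is `a 1`, moved to the first place by a transposition. The
        -- induction hypothesis bounds it up to `‖e 0‖²/4`.
        have h2 := hmin _ _ (hab.comp_equiv (Equiv.swap 0 1)) (fun i => hle (ha _))
          (fun i => hle (hb _))
        have h3 : (Equiv.swap (0 : Fin (n + 2)) 1) 0 = Fin.succ 0 := by simp
        simp only [Function.comp_apply, h3] at h2
        have h4 := hsucc 0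
        have h5 := hb' 0
        linarith
    intro i
    rw [reductionConst]
    refine Fin.cases ?_ (fun i => ?_) i
    · rwa [ha0]
    · have h4 := hsucc i
      have h5 := hb' i
      linarith

/-! ### Rows of a symplectic matrix as a lattice basis in `ℂⁿ` -/

namespace SiegelForms

open SiegelUpperHalfSpace

variable {n : ℕ}

/-- The identification `(c, d) ↦ ci + d` of `ℝ^{2n}` with `ℂ^n`. -/
noncomputable def rowToComplex (n : ℕ) : (Fin n ⊕ Fin n → ℝ) →+ EuclideanSpace ℂ (Fin n) where
  toFun v := WithLp.toLp 2 fun j => (v (Sum.inl j) : ℂ) * Complex.I + v (Sum.inr j)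
  map_zero' := by ext j; simp
  map_add' v w := by ext j; simp; ring

theorem rowToComplex_apply (v : Fin n ⊕ Fin n → ℝ) (j : Fin n) :
    rowToComplex n v j = (v (Sum.inl j) : ℂ) * Complex.I + v (Sum.inr j) := rfl

theorem im_inner_rowToComplex (v w : Fin n ⊕ Fin n → ℝ) :
    (inner ℂ (rowToComplex n v) (rowToComplex n w)).im = v ⬝ᵥ (J (Fin n) ℝ *ᵥ w) := by
  rw [PiLp.inner_apply, Complex.im_sum]
  simp only [J, dotProduct, fromBlocks_mulVec, Fintype.sum_sum_type, Sum.elim_inl, Sum.elim_inr,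
    ← Finset.sum_add_distrib]
  refine Finset.sum_congr rfl fun j _ => ?_
  simp [rowToComplex_apply, neg_mulVec]
  ring

theorem im_inner_rowToComplex_rows (M : Matrix (Fin n ⊕ Fin n) (Fin n ⊕ Fin n) ℝ)
    (s t : Fin n ⊕ Fin n) :
    (inner ℂ (rowToComplex n (M s)) (rowToComplex n (M t))).im = (M * J (Fin n) ℝ * Mᵀ) s t := by
  rw [im_inner_rowToComplex, Matrix.mul_assoc, Matrix.mul_apply_eq_vecMul]
  rfl

/-- The rows of a symplectic matrix, read in `ℂ^n`, form a symplectic system. -/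
theorem isSymplecticSystem_rows (g : Sp n ℝ) :
    IsSymplecticSystem (fun i => rowToComplex n (g.1 (Sum.inr i)))
      (fun i => rowToComplex n (g.1 (Sum.inl i))) := by
  have h := SymplecticGroup.mem_iff.mp g.2
  refine ⟨fun i j => ?_, fun i j => ?_, fun i j => ?_⟩ <;>
    rw [im_inner_rowToComplex_rows, h] <;> simp [J, Matrix.one_apply]

theorem exists_int_combination (g : Sp n ℝ) {y : EuclideanSpace ℂ (Fin n)}
    (hy : y ∈ systemSpan (fun i => rowToComplex n (g.1 (Sum.inr i)))
      (fun i => rowToComplex n (g.1 (Sum.inl i)))) :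
    ∃ c : Fin n ⊕ Fin n → ℤ, y = rowToComplex n ((fun s => (c s : ℝ)) ᵥ* g.1) := by
  have row (s : Fin n ⊕ Fin n) : ∃ c : Fin n ⊕ Fin n → ℤ,
      rowToComplex n (g.1 s) = rowToComplex n ((fun s => (c s : ℝ)) ᵥ* g.1) := by
    refine ⟨Pi.single s 1, ?_⟩
    have : (fun t => ((Pi.single s 1 : Fin n ⊕ Fin n → ℤ) t : ℝ)) = Pi.single s 1 := by
      ext t
      by_cases h : t = s
      · subst h; simp
      · simp [h]
    rw [this, Matrix.single_one_vecMul]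
    rfl
  induction hy using AddSubgroup.closure_induction with
  | mem y hy =>
    rcases hy with ⟨i, rfl⟩ | ⟨i, rfl⟩
    exacts [row _, row _]
  | zero =>
    refine ⟨0, ?_⟩
    have : (fun s => ((0 : Fin n ⊕ Fin n → ℤ) s : ℝ)) = 0 := by ext; simp
    rw [this, Matrix.zero_vecMul, map_zero]
  | add a b _ _ ha hb =>
    obtain ⟨c, rfl⟩ := ha
    obtain ⟨d, rfl⟩ := hb
    refine ⟨c + d, ?_⟩
    rw [← map_add, ← Matrix.add_vecMul]
    congr 2
    ext s
    simp
  | neg a _ ha =>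
    obtain ⟨c, rfl⟩ := ha
    refine ⟨-c, ?_⟩
    rw [← map_neg, ← Matrix.neg_vecMul]
    congr 2
    ext s
    simp

theorem denomMatrix_basePoint_apply (g : Sp n ℝ) (i j : Fin n) :
    denomMatrix g (basePoint n) i j = rowToComplex n (g.1 (Sum.inr i)) j := by
  simp [denomMatrix, basePoint, blockC, blockD, rowToComplex_apply, toBlocks₂₁, toBlocks₂₂,
    mul_comm]

theorem spMap_coe {R S : Type} [CommRing R] [CommRing S] (f : R →+* S) (g : Sp n R) :
    (spMap f g : Matrix (Fin n ⊕ Fin n) (Fin n ⊕ Fin n) S) = g.1.map f := rfl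

/-- Every `Sp_{2n}(ℤ)`-orbit in `Sp_{2n}(ℝ)` contains an element whose factor of automorphy at the
base point is bounded in terms of `n`. -/
theorem exists_reduced_denom (g : Sp n ℝ) : ∃ γ : Sp n ℤ, ∀ i,
    ∑ j, ‖denomMatrix (spMap (Int.castRingHom ℝ) γ * g) (basePoint n) i j‖ ^ 2 ≤
      reductionConst n := by
  obtain ⟨a, b, hab, ha, hb, hbound⟩ := IsSymplecticSystem.exists_reduced n
    (finrank_euclideanSpace_fin (𝕜 := ℂ) (n := n)) (isSymplecticSystem_rows g)
  choose ca hca using fun i => exists_int_combination g (ha i)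
  choose cb hcb using fun i => exists_int_combination g (hb i)
  -- The bounded half `a` supplies the lower rows, as these are the ones that enter `J(γg, i)`. Both
  -- `γg` and `g` preserve the form, hence so does `γ`; no proof that `a`, `b` generate the whole
  -- lattice is needed.
  set γ : Matrix (Fin n ⊕ Fin n) (Fin n ⊕ Fin n) ℤ := Matrix.of (Sum.elim cb ca) with hγ
  have hrow (s) : (γ.map (Int.castRingHom ℝ) * g.1) s = Sum.elim
      (fun i => (fun s => (cb i s : ℝ)) ᵥ* g.1) (fun i => (fun s => (ca i s : ℝ)) ᵥ* g.1) s := by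
    rw [Matrix.mul_apply_eq_vecMul]
    rcases s with i | i <;> rfl
  have hJ : (γ.map (Int.castRingHom ℝ) * g.1) * J (Fin n) ℝ *
      (γ.map (Int.castRingHom ℝ) * g.1)ᵀ = J (Fin n) ℝ := by
    ext s t
    rw [← im_inner_rowToComplex_rows, hrow, hrow]
    rcases s with i | i <;> rcases t with j | j <;>
      simp only [Sum.elim_inl, Sum.elim_inr, ← hca, ← hcb, hab.im_left, hab.im_right,
        hab.im_pair, hab.im_pair'] <;> simp [J, Matrix.one_apply]
    split_ifs <;> simp
  have hmem : γ ∈ symplecticGroup (Fin n) ℤ := by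
    rw [SymplecticGroup.mem_iff]
    have h : γ.map (Int.castRingHom ℝ) * J (Fin n) ℝ * (γ.map (Int.castRingHom ℝ))ᵀ =
        J (Fin n) ℝ := by
      have hg := SymplecticGroup.mem_iff.mp g.2
      calc _ = γ.map (Int.castRingHom ℝ) * (g.1 * J (Fin n) ℝ * g.1ᵀ) *
            (γ.map (Int.castRingHom ℝ))ᵀ := by rw [hg]
        _ = (γ.map (Int.castRingHom ℝ) * g.1) * J (Fin n) ℝ *
            (γ.map (Int.castRingHom ℝ) * g.1)ᵀ := by
          rw [Matrix.transpose_mul]; simp only [Matrix.mul_assoc]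
        _ = _ := hJ
    apply Matrix.map_injective (f := Int.castRingHom ℝ) Int.cast_injective
    simp only [Matrix.map_mul, Matrix.map_J, Matrix.transpose_map]
    exact h
  refine ⟨⟨γ, hmem⟩, fun i => ?_⟩
  have h := hbound i
  rw [EuclideanSpace.norm_sq_eq, hca] at h
  refine le_trans (le_of_eq (Finset.sum_congr rfl fun j _ => ?_)) h
  rw [denomMatrix_basePoint_apply]
  exact congrArg (fun v => ‖rowToComplex n v j‖ ^ 2) (hrow (Sum.inr i))

end SiegelForms

/-! ### Positive semidefinite real matrices -/

namespace Matrix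

variable {m : Type*} [Fintype m] [DecidableEq m]

theorem PosSemidef.one_le_det_one_add {P : Matrix m m ℝ} (hP : P.PosSemidef) :
    1 ≤ (1 + P).det := by
  have h : (1 + P).IsHermitian := (PosSemidef.one.add hP).isHermitian
  rw [h.det_eq_prod_eigenvalues]
  simp only [RCLike.ofReal_real_eq_id, id_eq]
  have hle (i : m) : 1 ≤ h.eigenvalues i := by
    have hv : star (h.eigenvectorBasis i : m → ℝ) ⬝ᵥ (h.eigenvectorBasis i : m → ℝ) = 1 := by
      have h1 := h.eigenvectorBasis.orthonormal.1 i
      have h2 := EuclideanSpace.norm_sq_eq (h.eigenvectorBasis i)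
      rw [h1] at h2
      simp [dotProduct, ← sq] at h2 ⊢
      exact h2.symm
    rw [h.eigenvalues_eq, Matrix.add_mulVec, Matrix.one_mulVec, dotProduct_add, hv]
    have := hP.dotProduct_mulVec_nonneg (h.eigenvectorBasis i)
    simpa using this
  calc (1 : ℝ) = ∏ _i : m, 1 := by simp
    _ ≤ _ := Finset.prod_le_prod (fun _ _ => zero_le_one) fun i _ => hle i

/-- Writing `A = S*S` and conjugating by `S⁻¹` reduces to `A = 1`, where all eigenvalues of the
larger matrix are at least `1`. -/
theorem PosDef.det_le_det_of_posSemidef_sub {A B : Matrix m m ℝ} (hA : A.PosDef)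
    (hAB : (B - A).PosSemidef) : A.det ≤ B.det := by
  obtain ⟨S, rfl⟩ : ∃ S, A = Sᴴ * S := by
    open scoped MatrixOrder in
    exact CStarAlgebra.nonneg_iff_eq_star_mul_self.mp hA.posSemidef.nonneg
  have hS : IsUnit S.det := by
    have h := hA.det_pos.ne'
    rw [det_mul] at h
    exact isUnit_iff_ne_zero.mpr (right_ne_zero_of_mul h)
  have hSH : IsUnit Sᴴ.det := by rw [det_conjTranspose]; exact hS.star
  have hP : ((S⁻¹)ᴴ * (B - Sᴴ * S) * S⁻¹).PosSemidef := hAB.conjTranspose_mul_mul_same _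
  have hB : B = Sᴴ * (1 + (S⁻¹)ᴴ * (B - Sᴴ * S) * S⁻¹) * S := by
    rw [Matrix.mul_add, Matrix.add_mul, Matrix.mul_one, conjTranspose_nonsing_inv,
      ← Matrix.mul_assoc, ← Matrix.mul_assoc, Matrix.mul_nonsing_inv _ hSH, Matrix.one_mul,
      Matrix.nonsing_inv_mul_cancel_right _ _ hS]
    abel
  have h1 := hP.one_le_det_one_add
  have h0 := hA.det_pos
  rw [det_mul] at h0
  rw [hB, det_mul, det_mul, det_mul]
  nlinarith

/-- Both `B - A` and `A⁻¹ - B⁻¹` are Schur complements of the same block matrix with diagonal blocks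
`B`, `A⁻¹` and off-diagonal blocks `1`. -/
theorem PosDef.posSemidef_inv_sub_inv {A B : Matrix m m ℝ} (hA : A.PosDef) (hB : B.PosDef)
    (hAB : (B - A).PosSemidef) : (A⁻¹ - B⁻¹).PosSemidef := by
  let _ := hB.isUnit.invertible
  let _ := hA.inv.isUnit.invertible
  have h1 := PosDef.fromBlocks₁₁ (1 : Matrix m m ℝ) A⁻¹ hB
  have h2 := PosDef.fromBlocks₂₂ B (1 : Matrix m m ℝ) hA.inv
  rw [conjTranspose_one, Matrix.one_mul, Matrix.mul_one] at h1 h2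
  rw [nonsing_inv_nonsing_inv _ ((isUnit_iff_isUnit_det _).mp hA.isUnit)] at h2
  exact h1.mp (h2.mpr hAB)

/-- With `A = S*S`, cyclicity gives `Tr(AB) = Tr(SBS*)`. This makes `e^{-2π Tr(SY)}` decrease as `Y`
grows. -/
theorem PosSemidef.trace_mul_nonneg {A B : Matrix m m ℝ} (hA : A.PosSemidef)
    (hB : B.PosSemidef) : 0 ≤ (A * B).trace := by
  obtain ⟨S, rfl⟩ : ∃ S, A = Sᴴ * S := by
    open scoped MatrixOrder in
    exact CStarAlgebra.nonneg_iff_eq_star_mul_self.mp hA.nonneg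
  rw [Matrix.mul_assoc, Matrix.trace_mul_comm]
  exact (hB.mul_mul_conjTranspose_same S).trace_nonneg

/-- This is Cauchy–Schwarz applied to each row of `M`. -/
theorem posSemidef_trace_smul_one_sub {k : Type*} [Fintype k] (M : Matrix k m ℝ) :
    ((Mᵀ * M).trace • (1 : Matrix m m ℝ) - Mᵀ * M).PosSemidef := by
  refine PosSemidef.of_dotProduct_mulVec_nonneg ?_ fun x => ?_
  · have h : (Mᵀ * M)ᵀ = Mᵀ * M := by simp
    rw [IsHermitian, conjTranspose_eq_transpose_of_trivial, transpose_sub, h, transpose_smul,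
      transpose_one]
  · rw [sub_mulVec, dotProduct_sub, smul_mulVec, one_mulVec, dotProduct_smul, ← mulVec_mulVec,
      dotProduct_mulVec, vecMul_transpose, star_trivial, sub_nonneg, trace, smul_eq_mul]
    have htr : ∑ j, diag (Mᵀ * M) j = ∑ i, ∑ j, M i j ^ 2 := by
      rw [Finset.sum_comm]
      refine Finset.sum_congr rfl fun j _ => ?_
      simp [Matrix.mul_apply, sq]
    rw [htr, Finset.sum_mul]
    refine Finset.sum_le_sum fun i _ => ?_
    have := Finset.sum_mul_sq_le_sq_mul_sq Finset.univ (M i) x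
    simpa [mulVec, dotProduct, sq] using this

end Matrix

/-! ### The Gram matrix of the lower rows and the size of `det J(γg, i)` -/

namespace SiegelForms

open SiegelUpperHalfSpace

variable {n : ℕ}

/-- The Gram matrix `CCᵀ + DDᵀ` of the lower rows of `g = [A B; C D]`. -/
def lowerGram (g : Sp n ℝ) : Matrix (Fin n) (Fin n) ℝ :=
  g.1.submatrix Sum.inr id * (g.1.submatrix Sum.inr id)ᵀ

/-- The real part is the Euclidean product of the rows. The imaginary part vanishes because the
lower rows span an isotropic subspace. -/
theorem lowerGram_apply_eq_inner (g : Sp n ℝ) (i j : Fin n) :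
    (lowerGram g i j : ℂ) =
      inner ℂ (rowToComplex n (g.1 (Sum.inr j))) (rowToComplex n (g.1 (Sum.inr i))) := by
  apply Complex.ext
  · rw [PiLp.inner_apply, Complex.re_sum, Complex.ofReal_re]
    simp only [lowerGram, Matrix.mul_apply, Fintype.sum_sum_type, submatrix_apply, id_eq,
      transpose_apply, ← Finset.sum_add_distrib]
    refine Finset.sum_congr rfl fun k _ => ?_
    simp [rowToComplex_apply]
    ring
  · rw [(isSymplecticSystem_rows g).im_left, Complex.ofReal_im]

theorem denom_mul_conjTranspose (g : Sp n ℝ) :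
    denomMatrix g (basePoint n) * (denomMatrix g (basePoint n))ᴴ =
      (lowerGram g).map Complex.ofReal := by
  ext i j
  rw [map_apply, lowerGram_apply_eq_inner, PiLp.inner_apply, Matrix.mul_apply]
  refine Finset.sum_congr rfl fun k _ => ?_
  simp only [conjTranspose_apply, denomMatrix_basePoint_apply, RCLike.inner_apply]
  rfl

theorem norm_det_denom_sq (g : Sp n ℝ) :
    ‖(denomMatrix g (basePoint n)).det‖ ^ 2 = (lowerGram g).det := by
  have h := congrArg det (denom_mul_conjTranspose g)
  rw [det_mul, det_conjTranspose, Complex.star_def, Complex.mul_conj] at h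
  have h2 : ((lowerGram g).map Complex.ofReal).det = ((lowerGram g).det : ℂ) :=
    (RingHom.map_det Complex.ofRealHom _).symm
  rw [h2, Complex.ofReal_inj] at h
  rw [← h, Complex.normSq_eq_norm_sq]

theorem lowerGram_posDef (g : Sp n ℝ) : (lowerGram g).PosDef := by
  have h : (lowerGram g).PosSemidef := posSemidef_self_mul_conjTranspose _
  rw [h.posDef_iff_det_ne_zero, ← norm_det_denom_sq]
  exact pow_ne_zero 2 (norm_ne_zero_iff.mpr (isUnit_det_denom g _).ne_zero)

/-- The imaginary part of `g · i` is the inverse of `CCᵀ + DDᵀ`. -/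
theorem inv_imPart_act_basePoint (g : Sp n ℝ) :
    (imPart (act g (basePoint n)))⁻¹ = lowerGram g := by
  set d := denomMatrix g (basePoint n) with hd
  set Y := imPart (act g (basePoint n)) with hY
  have hu : IsUnit d.det := isUnit_det_denom g _
  have hus : IsUnit dᴴ.det := by rw [det_conjTranspose]; exact hu.star
  have h := denom_star_mul_num g (basePoint n)
  have h1 : imPart (basePoint n) = 1 := by
    ext i j
    by_cases hij : i = j <;> simp [imPart, basePoint, Matrix.one_apply, hij]
  have hnum : numMatrix g (basePoint n) = (act g (basePoint n)).1 * d := by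
    rw [act, Matrix.nonsing_inv_mul_cancel_right _ _ hu]
  have hZ : (act g (basePoint n)).1 - (act g (basePoint n)).1ᴴ =
      (2 * Complex.I) • Y.map Complex.ofReal := by
    ext i j
    have := (act g (basePoint n)).2.1.apply i j
    rw [Matrix.sub_apply, conjTranspose_apply, this, Matrix.smul_apply, map_apply, hY, imPart,
      map_apply, smul_eq_mul]
    apply Complex.ext <;> simp
    ring
  rw [h1, hnum, ← hd, conjTranspose_mul, ← Matrix.mul_assoc, ← Matrix.sub_mul, ← Matrix.mul_sub,
    hZ, Matrix.mul_smul, Matrix.smul_mul] at h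
  have h2 : dᴴ * Y.map Complex.ofReal * d = 1 := by
    have := smul_right_injective _ (by simp : (2 * Complex.I) ≠ 0) h
    simpa using this
  -- From `d*Yd = 1`, moving the right factor `d` to the front gives `(dd*)Y = 1`.
  rw [mul_eq_one_comm, ← Matrix.mul_assoc, denom_mul_conjTranspose] at h2
  refine Matrix.inv_eq_left_inv ?_
  apply Matrix.map_injective (f := Complex.ofRealHom) Complex.ofReal_injective
  simp only [Matrix.map_mul, Matrix.map_one _ (map_zero Complex.ofRealHom) (map_one _)]
  exact h2

theorem traceNorm_eq (g : Sp n ℝ) : traceNorm g = (g.1 * g.1ᵀ).trace := by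
  rw [traceNorm, conjTranspose_eq_transpose_of_trivial, Matrix.trace_mul_comm]

theorem posDef_transpose_mul_self (g : Sp n ℝ) : (g.1ᵀ * g.1).PosDef := by
  have hgi : g.1 * (g⁻¹).1 = 1 := congrArg Subtype.val (mul_inv_cancel g)
  have hu : IsUnit g.1 := IsUnit.of_mul_eq_one _ hgi
  refine (PosSemidef.posDef_iff_isUnit (posSemidef_conjTranspose_mul_self g.1)).mpr ?_
  rw [conjTranspose_eq_transpose_of_trivial]
  exact (((isUnit_iff_isUnit_det _).mpr (by
    rw [det_transpose]; exact (isUnit_iff_isUnit_det _).mp hu)) : IsUnit g.1ᵀ).mul hu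

theorem traceNorm_pos [NeZero n] (g : Sp n ℝ) : 0 < traceNorm g :=
  (posDef_transpose_mul_self g).trace_pos

/-- The inverse is `-J gᵀ J` with `J` orthogonal, so it has the same Frobenius norm as `g`. -/
theorem traceNorm_inv (g : Sp n ℝ) : traceNorm g⁻¹ = traceNorm g := by
  have hJ : J (Fin n) ℝ * J (Fin n) ℝ = -1 := J_squared _ _
  rw [traceNorm_eq, traceNorm_eq, SymplecticGroup.coe_inv]
  simp only [Matrix.transpose_mul, Matrix.transpose_neg, J_transpose, Matrix.transpose_transpose,
    neg_neg]
  have hm (X : Matrix (Fin n ⊕ Fin n) (Fin n ⊕ Fin n) ℝ) :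
      J (Fin n) ℝ * (J (Fin n) ℝ * X) = -X := by rw [← Matrix.mul_assoc, hJ]; simp
  simp only [Matrix.mul_assoc, Matrix.neg_mul, Matrix.mul_neg, neg_neg, hm]
  rw [Matrix.trace_neg, Matrix.trace_mul_comm]
  simp only [Matrix.mul_assoc, hJ, Matrix.mul_neg, Matrix.mul_one, Matrix.trace_neg, neg_neg]
  exact Matrix.trace_mul_comm _ _

/-- `g gᵀ ≥ Tr(g*g)⁻¹` for a symplectic matrix `g`. -/
theorem posSemidef_mul_transpose_sub [NeZero n] (g : Sp n ℝ) :
    (g.1 * g.1ᵀ - (traceNorm g)⁻¹ • 1).PosSemidef := by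
  have hgi : g.1 * (g⁻¹).1 = 1 := congrArg Subtype.val (mul_inv_cancel g)
  have hig : (g⁻¹).1 * g.1 = 1 := congrArg Subtype.val (inv_mul_cancel g)
  have hP : g.1 * g.1ᵀ * ((g⁻¹).1ᵀ * (g⁻¹).1) = 1 := by
    rw [Matrix.mul_assoc, ← Matrix.mul_assoc g.1ᵀ, ← Matrix.transpose_mul, hig,
      Matrix.transpose_one, Matrix.one_mul, hgi]
  have hQ : ((g⁻¹).1ᵀ * (g⁻¹).1).PosDef := posDef_transpose_mul_self g⁻¹
  have htr : ((g⁻¹).1ᵀ * (g⁻¹).1).trace = traceNorm g := by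
    rw [← traceNorm_inv, traceNorm_eq, Matrix.trace_mul_comm]
  have hpos := traceNorm_pos g
  -- The trace bound gives `(ggᵀ)⁻¹ ≤ Tr(g*g)`, since `g⁻¹` and `g` have the same trace norm;
  -- inverting reverses the inequality.
  have h := posSemidef_trace_smul_one_sub (g⁻¹).1
  rw [htr] at h
  have h2 := hQ.posSemidef_inv_sub_inv (PosDef.one.smul hpos) h
  have h3 : (traceNorm g • (1 : Matrix (Fin n ⊕ Fin n) (Fin n ⊕ Fin n) ℝ))⁻¹ =
      (traceNorm g)⁻¹ • 1 := by
    refine Matrix.inv_eq_left_inv ?_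
    rw [smul_mul_smul_comm, inv_mul_cancel₀ hpos.ne', Matrix.one_mul, one_smul]
  rwa [Matrix.inv_eq_left_inv hP, h3] at h2

/-- Taking traces in `ggᵀ ≥ τ⁻¹` with `τ = Tr(g*g)` gives `τ ≥ 2n/τ`. It is needed to enlarge the
exponent in the final bound. -/
theorem one_le_traceNorm [NeZero n] (g : Sp n ℝ) : 1 ≤ traceNorm g := by
  have h := (posSemidef_mul_transpose_sub g).trace_nonneg
  rw [Matrix.trace_sub, ← traceNorm_eq, Matrix.trace_smul, Matrix.trace_one, Fintype.card_sum,
    Fintype.card_fin, smul_eq_mul] at h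
  have h0 := traceNorm_pos g
  have hn : (1 : ℝ) ≤ n := by exact_mod_cast NeZero.one_le
  by_contra! hlt
  have : 1 ≤ (traceNorm g)⁻¹ := (one_le_inv₀ h0).mpr hlt.le
  push_cast at h
  nlinarith

/-- The determinant of the factor of automorphy of `γg`, for integral `γ`, is not small. -/
theorem one_le_traceNorm_pow_mul_norm_det_sq [NeZero n] (γ : Sp n ℤ) (g : Sp n ℝ) :
    1 ≤ traceNorm g ^ n *
      ‖(denomMatrix (spMap (Int.castRingHom ℝ) γ * g) (basePoint n)).det‖ ^ 2 := by
  have hpos : 0 < traceNorm g := zero_lt_one.trans_le (one_le_traceNorm g)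
  set γ' := spMap (Int.castRingHom ℝ) γ with hγ'
  have hA := (lowerGram_posDef γ').smul (inv_pos.mpr hpos)
  have hsub : (lowerGram (γ' * g) - (traceNorm g)⁻¹ • lowerGram γ').PosSemidef := by
    have h := (posSemidef_mul_transpose_sub g).mul_mul_conjTranspose_same
      (γ'.1.submatrix Sum.inr id)
    have hrow : (γ' * g).1.submatrix Sum.inr id = γ'.1.submatrix Sum.inr id * g.1 := rfl
    convert h using 1
    rw [Matrix.mul_sub, Matrix.sub_mul, lowerGram, hrow, lowerGram, Matrix.transpose_mul,
      conjTranspose_eq_transpose_of_trivial, Matrix.mul_smul, Matrix.smul_mul, Matrix.mul_one]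
    simp only [Matrix.mul_assoc]
  -- The Gram matrix of integral rows has an integer determinant, and it is positive.
  have hint : 1 ≤ (lowerGram γ').det := by
    have h : (lowerGram γ').det =
        (((γ.1.submatrix Sum.inr id * (γ.1.submatrix Sum.inr id)ᵀ).det : ℤ) : ℝ) := by
      rw [← eq_intCast (Int.castRingHom ℝ), RingHom.map_det, RingHom.mapMatrix_apply,
        Matrix.map_mul]
      rfl
    have h0 := (lowerGram_posDef γ').det_pos
    rw [h] at h0 ⊢
    exact_mod_cast h0
  have hle := hA.det_le_det_of_posSemidef_sub hsub
  rw [det_smul, Fintype.card_fin, inv_pow] at hle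
  rw [norm_det_denom_sq]
  have h1 : (traceNorm g ^ n)⁻¹ ≤ (lowerGram (γ' * g)).det :=
    (le_mul_of_one_le_right (by positivity) hint).trans hle
  rwa [inv_le_iff_one_le_mul₀' (by positivity)] at h1

end SiegelForms

/-! ### Growth of irreducible rational representations of `GL_n(ℂ)` -/

namespace SiegelForms

variable {n : ℕ}

/-- The QR decomposition. -/
theorem exists_unitary_mul_upperTriangular (h : GeneralLinearGroup (Fin n) ℂ) :
    ∃ k b : GeneralLinearGroup (Fin n) ℂ, h = k * b ∧ k.1ᴴ * k.1 = 1 ∧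
      ∀ i j, j < i → b.1 i j = 0 := by
  set q := InnerProductSpace.gramSchmidtOrthonormalBasis (𝕜 := ℂ)
    (E := EuclideanSpace ℂ (Fin n)) (by simp) (fun j => WithLp.toLp 2 fun a => h.1 a j) with hq
  set K : Matrix (Fin n) (Fin n) ℂ := Matrix.of fun a i => q i a with hK
  have hKK : Kᴴ * K = 1 := by
    ext i j
    have := orthonormal_iff_ite.mp q.orthonormal i j
    rw [Matrix.one_apply, ← this, PiLp.inner_apply, Matrix.mul_apply]
    refine Finset.sum_congr rfl fun a _ => ?_
    simp [hK, mul_comm]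
  let k : GeneralLinearGroup (Fin n) ℂ := ⟨K, Kᴴ, mul_eq_one_comm.mp hKK, hKK⟩
  refine ⟨k, k⁻¹ * h, by simp, hKK, fun i j hij => ?_⟩
  have h0 := InnerProductSpace.gramSchmidtOrthonormalBasis_inv_triangular (𝕜 := ℂ)
    (E := EuclideanSpace ℂ (Fin n)) (by simp) (fun j => WithLp.toLp 2 fun a => h.1 a j) hij
  rw [← hq, PiLp.inner_apply] at h0
  rw [← h0]
  change (Kᴴ * h.1) i j = _
  rw [Matrix.mul_apply]
  refine Finset.sum_congr rfl fun a _ => ?_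
  simp [hK, mul_comm]

theorem norm_apply_le_one_of_unitary {K : Matrix (Fin n) (Fin n) ℂ} (hK : Kᴴ * K = 1)
    (i j : Fin n) : ‖K i j‖ ≤ 1 :=
  entry_norm_bound_of_unitary (𝕜 := ℂ) (by
    rw [Matrix.mem_unitaryGroup_iff']; exact hK) i j

theorem norm_det_eq_one_of_unitary {K : Matrix (Fin n) (Fin n) ℂ} (hK : Kᴴ * K = 1) :
    ‖K.det‖ = 1 := by
  have h := congrArg (fun M => ‖M.det‖) hK
  simp only [det_mul, det_conjTranspose, norm_mul, norm_star, det_one, norm_one] at h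
  nlinarith [norm_nonneg K.det]

theorem exists_bound_eval {σ : Type*} [Finite σ] (P : MvPolynomial σ ℂ) (R : ℝ) :
    ∃ C, ∀ x : σ → ℂ, (∀ i, ‖x i‖ ≤ R) → ‖MvPolynomial.eval x P‖ ≤ C := by
  have := Fintype.ofFinite σ
  obtain ⟨C, hC⟩ := (isCompact_univ_pi fun _ : σ => isCompact_closedBall (0 : ℂ) R)
    |>.exists_bound_of_continuousOn (MvPolynomial.continuous_eval P).continuousOn
  exact ⟨C, fun x hx => hC x fun i _ => by simpa using hx i⟩

/-- The inverse diagonal entries of an upper triangular matrix are those of its inverse. -/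
theorem inv_apply_mul_apply_self (b : GeneralLinearGroup (Fin n) ℂ)
    (hb : ∀ i j, j < i → b.1 i j = 0) (i : Fin n) : (b⁻¹).1 i i * b.1 i i = 1 := by
  have hbt : b.1.BlockTriangular id := fun i j hij => hb i j hij
  have hinv : (b⁻¹).1.BlockTriangular id := by
    have := b.invertible
    rw [GeneralLinearGroup.coe_inv]
    exact blockTriangular_inv_of_blockTriangular hbt
  have h : ((b⁻¹).1 * b.1) i i = 1 := by
    rw [show (b⁻¹).1 * b.1 = 1 from b.inv_val]
    simp
  rw [Matrix.mul_apply, Finset.sum_eq_single i ?_ (fun h => absurd (Finset.mem_univ i) h)] at h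
  · exact h
  intro j _ hj
  rcases lt_or_gt_of_ne hj with hlt | hlt
  · rw [hinv hlt, zero_mul]
  · rw [hb j i hlt, mul_zero]

section Representations

variable {V : Type*} [AddCommGroup V] [Module ℂ V]
  {ρ : Representation ℂ (GeneralLinearGroup (Fin n) ℂ) V}

/-- On unitary matrices the entries have modulus at most `1` and the determinant has modulus `1`, so
the denominator is harmless and the numerator is a polynomial on a bounded set. -/
theorem IsRational.exists_bound_unitary (hrat : IsRational ρ) (l : V →ₗ[ℂ] ℂ) (v : V) :
    ∃ C, ∀ k : GeneralLinearGroup (Fin n) ℂ, k.1ᴴ * k.1 = 1 → ‖l (ρ k v)‖ ≤ C := by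
  obtain ⟨P, m, hP⟩ := hrat l v
  obtain ⟨C, hC⟩ := exists_bound_eval P 1
  refine ⟨C, fun k hk => ?_⟩
  rw [hP, norm_mul, norm_inv, norm_pow, norm_det_eq_one_of_unitary hk, one_pow, inv_one, mul_one]
  exact hC _ fun ij => norm_apply_le_one_of_unitary hk _ _

/-- The orbit of a highest weight vector: `det(B)^{λ₀} ρ(B⁻¹g) v` stays bounded for bounded `B`. -/
theorem exists_bound_highestWeightVector (hrat : IsRational ρ) {lam : Fin n → ℤ} {l₀ : ℤ}
    (hlam : ∀ i, lam i ≤ l₀) {v : V}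
    (hv : ∀ b : GeneralLinearGroup (Fin n) ℂ, (∀ i j, j < i → b.1 i j = 0) →
      ρ b v = (∏ i, b.1 i i ^ lam i) • v)
    (L : V →ₗ[ℂ] ℂ) (R : ℝ) (g : GeneralLinearGroup (Fin n) ℂ) :
    ∃ C, ∀ B : GeneralLinearGroup (Fin n) ℂ, (∀ i j, ‖B.1 i j‖ ≤ R) →
      ‖L (ρ B⁻¹ (ρ g v))‖ * ‖B.1.det‖ ^ l₀ ≤ C := by
  obtain ⟨C, hC⟩ := hrat.exists_bound_unitary L v
  set M : ℝ := ∑ i, ∑ _l : Fin n, ∑ j, ‖(g⁻¹).1 i j‖ * R with hM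
  refine ⟨‖g.1.det‖ ^ l₀ * (∏ i, M ^ (l₀ - lam i)) * C, fun B hB => ?_⟩
  obtain ⟨k, b, hkb, hk, hb⟩ := exists_unitary_mul_upperTriangular (B⁻¹ * g)
  have hR : ∀ i j : Fin n, 0 ≤ ‖(g⁻¹).1 i j‖ * R := fun i j =>
    mul_nonneg (norm_nonneg _) ((norm_nonneg _).trans (hB i j))
  have hb0 (i : Fin n) : b.1 i i ≠ 0 := right_ne_zero_of_mul_eq_one (inv_apply_mul_apply_self b hb i)
  -- From `B⁻¹g = kb` one gets `b⁻¹ = g⁻¹Bk`, which is bounded when `B` is; its diagonal consists of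
  -- the inverses of the `b_ii`.
  have hinv (i : Fin n) : ‖b.1 i i‖⁻¹ ≤ M := by
    have h1 : b⁻¹ = g⁻¹ * B * k := by
      rw [eq_comm, ← mul_eq_one_iff_eq_inv, mul_assoc _ k b, ← hkb]
      group
    rw [← norm_inv, ← eq_inv_of_mul_eq_one_left (inv_apply_mul_apply_self b hb i), h1]
    change ‖((g⁻¹).1 * B.1 * k.1) i i‖ ≤ M
    rw [Matrix.mul_apply]
    have h2 : ‖∑ l, ((g⁻¹).1 * B.1) i l * k.1 l i‖ ≤ ∑ _l : Fin n, ∑ j, ‖(g⁻¹).1 i j‖ * R := by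
      refine (norm_sum_le _ _).trans (Finset.sum_le_sum fun l _ => ?_)
      rw [norm_mul, Matrix.mul_apply]
      refine (mul_le_of_le_one_right (norm_nonneg _)
        (norm_apply_le_one_of_unitary hk l i)).trans ?_
      refine (norm_sum_le _ _).trans (Finset.sum_le_sum fun j _ => ?_)
      rw [norm_mul]
      exact mul_le_mul_of_nonneg_left (hB j l) (norm_nonneg _)
    refine h2.trans ?_
    exact Finset.single_le_sum (f := fun i => ∑ _l : Fin n, ∑ j, ‖(g⁻¹).1 i j‖ * R)
      (fun i _ => Finset.sum_nonneg fun _ _ => Finset.sum_nonneg fun j _ => hR i j)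
      (Finset.mem_univ i)
  have hdet : ‖B.1.det‖ = ‖g.1.det‖ * ∏ i, ‖b.1 i i‖⁻¹ := by
    have h1 : B.1 * (k.1 * b.1) = g.1 := by
      have h3 : B * (k * b) = g := by rw [← hkb]; group
      exact congrArg Units.val h3
    have h2 := congrArg (fun X => ‖X.det‖) h1
    have hbt : b.1.BlockTriangular id := fun i j hij => hb i j hij
    simp only [det_mul, norm_mul, norm_det_eq_one_of_unitary hk, one_mul,
      det_of_isUpperTriangular hbt, norm_prod] at h2
    rw [← h2, mul_assoc, ← Finset.prod_mul_distrib]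
    simp [hb0]
  have hvec : ρ B⁻¹ (ρ g v) = (∏ i, b.1 i i ^ lam i) • ρ k v := by
    rw [← Module.End.mul_apply, ← map_mul, hkb, map_mul, Module.End.mul_apply, hv b hb, map_smul]
  rw [hvec, map_smul, smul_eq_mul, norm_mul, norm_prod, hdet, mul_zpow, ← Finset.prod_zpow]
  -- The power of `det B` turns the weight into `∏ |b_ii|⁻¹ ^ (l₀ - λ_i)`. The exponents are
  -- non-negative, so upper bounds for `|b_ii|⁻¹` suffice.
  have hprod : (∏ i, ‖b.1 i i ^ lam i‖) * ∏ i, ‖b.1 i i‖⁻¹ ^ l₀ =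
      ∏ i, ‖b.1 i i‖⁻¹ ^ (l₀ - lam i) := by
    rw [← Finset.prod_mul_distrib]
    refine Finset.prod_congr rfl fun i _ => ?_
    have h0 : ‖b.1 i i‖ ≠ 0 := norm_ne_zero_iff.mpr (hb0 i)
    rw [norm_zpow, zpow_sub₀ (inv_ne_zero h0), _root_.inv_zpow _ (lam i), div_inv_eq_mul, mul_comm]
  have hle : ∏ i, ‖b.1 i i‖⁻¹ ^ (l₀ - lam i) ≤ ∏ i, M ^ (l₀ - lam i) :=
    Finset.prod_le_prod (fun i _ => by positivity) fun i _ =>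
      zpow_le_zpow_left₀ (sub_nonneg.mpr (hlam i)) (by positivity) (hinv i)
  calc _ = ‖g.1.det‖ ^ l₀ *
        ((∏ i, ‖b.1 i i ^ lam i‖) * ∏ i, ‖b.1 i i‖⁻¹ ^ l₀) * ‖L (ρ k v)‖ := by ring
    _ ≤ _ := by
      rw [hprod]
      have : 0 ≤ ∏ i, ‖b.1 i i‖⁻¹ ^ (l₀ - lam i) := Finset.prod_nonneg fun i _ => by positivity
      exact mul_le_mul (mul_le_mul_of_nonneg_left hle (by positivity)) (hC k hk) (norm_nonneg _)
        (mul_nonneg (by positivity) (this.trans hle))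

/-- For an irreducible rational representation with highest weight `λ`, the matrix coefficients of
`det(B)^{λ₀} ρ(B)⁻¹` are bounded for bounded `B`, if `λ₀` is at least every `λ_i`. -/
theorem exists_bound_inv_mul_det (hrat : IsRational ρ) (hirr : ρ.IsIrreducible)
    {lam : Fin n → ℤ} {l₀ : ℤ} (hlam : ∀ i, lam i ≤ l₀) (hweight : IsHighestWeight ρ lam)
    (L : V →ₗ[ℂ] ℂ) (R : ℝ) (v : V) :
    ∃ C, ∀ B : GeneralLinearGroup (Fin n) ℂ, (∀ i j, ‖B.1 i j‖ ≤ R) →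
      ‖L (ρ B⁻¹ v)‖ * ‖B.1.det‖ ^ l₀ ≤ C := by
  obtain ⟨v₀, hv₀, hv⟩ := hweight
  -- Requiring the bound for every translate `ρ g v`, with a constant depending on `g`, makes the
  -- set of good vectors stable under the group. It contains `v₀ ≠ 0`, so by irreducibility it is
  -- everything.
  let W : Subrepresentation ρ :=
    { toSubmodule := {
          carrier := {v | ∀ g : GeneralLinearGroup (Fin n) ℂ, ∃ C,
            ∀ B : GeneralLinearGroup (Fin n) ℂ, (∀ i j, ‖B.1 i j‖ ≤ R) →
              ‖L (ρ B⁻¹ (ρ g v))‖ * ‖B.1.det‖ ^ l₀ ≤ C}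
          zero_mem' := fun g => ⟨0, fun B _ => by simp⟩
          add_mem' := by
            intro a b ha hb g
            obtain ⟨C, hC⟩ := ha g
            obtain ⟨D, hD⟩ := hb g
            refine ⟨C + D, fun B hB => ?_⟩
            rw [map_add, map_add, map_add]
            refine (mul_le_mul_of_nonneg_right (norm_add_le _ _) (by positivity)).trans ?_
            rw [add_mul]
            exact add_le_add (hC B hB) (hD B hB)
          smul_mem' := by
            intro c a ha g
            obtain ⟨C, hC⟩ := ha g
            refine ⟨‖c‖ * C, fun B hB => ?_⟩
            rw [map_smul, map_smul, map_smul, smul_eq_mul, norm_mul, mul_assoc]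
            exact mul_le_mul_of_nonneg_left (hC B hB) (norm_nonneg _) }
      apply_mem_toSubmodule := by
        intro h a ha g
        obtain ⟨C, hC⟩ := ha (g * h)
        refine ⟨C, fun B hB => ?_⟩
        rw [← Module.End.mul_apply (ρ g), ← map_mul]
        exact hC B hB }
  have hmem : v₀ ∈ W := fun g => exists_bound_highestWeightVector hrat hlam hv L R g
  have hW : W = ⊤ := by
    refine (hirr.eq_bot_or_eq_top W).resolve_left fun h => hv₀ ?_
    rw [h] at hmem
    exact (Submodule.mem_bot ℂ).mp hmem
  have hvW : v ∈ W := by rw [hW]; trivial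
  obtain ⟨C, hC⟩ := hvW 1
  exact ⟨C, fun B hB => by simpa using hC B hB⟩

end Representations

end SiegelForms

/-! ### Boundedness of functions with a nice Fourier expansion -/

namespace SiegelForms

open SiegelUpperHalfSpace

variable {n : ℕ}

/-- The point `iY` of `ℍ_n`. -/
noncomputable def imagPoint (Y : Matrix (Fin n) (Fin n) ℝ) (hY : Y.PosDef) :
    SiegelUpperHalfSpace n :=
  ⟨Complex.I • Y.map Complex.ofReal, by
    have h : (Complex.I • Y.map Complex.ofReal).map Complex.im = Y := by
      ext i j
      simp
    refine ⟨?_, by rwa [h]⟩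
    ext i j
    have := hY.isHermitian.apply i j
    simp only [star_trivial] at this
    simp [this]⟩

theorem imPart_imagPoint (Y : Matrix (Fin n) (Fin n) ℝ) (hY : Y.PosDef) :
    imPart (imagPoint Y hY) = Y := by
  ext i j
  simp [imPart, imagPoint]

theorem norm_exp_trace (S : Matrix (Fin n) (Fin n) ℝ) (Z : SiegelUpperHalfSpace n) :
    ‖Complex.exp (2 * Real.pi * Complex.I *
      (S.map Complex.ofReal * (Z : Matrix (Fin n) (Fin n) ℂ)).trace)‖ =
      Real.exp (-(2 * Real.pi * (S * imPart Z).trace)) := by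
  have him : (S.map Complex.ofReal * (Z : Matrix (Fin n) (Fin n) ℂ)).trace.im =
      (S * imPart Z).trace := by
    simp [Matrix.trace, Matrix.mul_apply, imPart, Complex.im_sum]
  rw [Complex.norm_exp, ← him]
  congr 1
  simp [Complex.mul_re, Complex.mul_im]

/-- A Fourier term decreases when `Y` grows and the entries of `Y⁻¹` shrink in absolute value. -/
theorem norm_fourierTerm_le {p N : ℕ} (a : exponents n p → latticePSD n N → ℂ)
    (x : exponents n p × latticePSD n N) {Z W : SiegelUpperHalfSpace n}
    (h : (imPart Z - imPart W).PosSemidef)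
    (hentry : ∀ i j, |(imPart Z)⁻¹ i j| ≤ |(imPart W)⁻¹ i j|) :
    ‖fourierTerm a x Z‖ ≤ ‖fourierTerm a x W‖ := by
  have htr := PosSemidef.trace_mul_nonneg x.2.2.1 h
  rw [Matrix.mul_sub, Matrix.trace_sub] at htr
  have hmon : ‖(monomial (imPart Z)⁻¹ x.1 : ℂ)‖ ≤ ‖(monomial (imPart W)⁻¹ x.1 : ℂ)‖ := by
    rw [Complex.norm_real, Complex.norm_real, monomial, monomial, norm_prod, norm_prod]
    refine Finset.prod_le_prod (fun _ _ => norm_nonneg _) fun ij _ => ?_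
    rw [norm_pow, norm_pow]
    exact pow_le_pow_left₀ (norm_nonneg _) (hentry _ _) _
  rw [fourierTerm, fourierTerm, norm_mul, norm_mul, norm_mul, norm_mul, norm_exp_trace,
    norm_exp_trace]
  have hpi := Real.pi_pos
  gcongr
  linarith

/-- A function with a nice Fourier expansion is bounded on every region where `Y` is bounded
below. -/
theorem HasNiceFourierExpansion.exists_bound {p : ℕ} {f : SiegelUpperHalfSpace n → ℂ}
    (hf : HasNiceFourierExpansion p f) {K : ℝ} (hK : 0 < K) :
    ∃ C, ∀ Z : SiegelUpperHalfSpace n, (K • 1 - (imPart Z)⁻¹).PosSemidef →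
      (∀ i j, |(imPart Z)⁻¹ i j| ≤ K) → ‖f Z‖ ≤ C := by
  obtain ⟨N, -, a, hsum, hunif⟩ := hf
  have hones : (vecMulVec (1 : Fin n → ℝ) 1).PosSemidef := by
    simpa using posSemidef_vecMulVec_self_star (1 : Fin n → ℝ)
  -- The comparison point `W = iH⁻¹` needs `H ≥ K` as a quadratic form and all entries of `H` at
  -- least `K`, so that both the exponential and the monomial factor are dominated. Adding the
  -- all-ones matrix achieves both.
  set H : Matrix (Fin n) (Fin n) ℝ := K • (1 + vecMulVec 1 1) with hH
  have hHpos : H.PosDef := (PosDef.one.add_posSemidef hones).smul hK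
  set W := imagPoint H⁻¹ hHpos.inv with hW
  have hWinv : (imPart W)⁻¹ = H := by
    rw [hW, imPart_imagPoint, nonsing_inv_nonsing_inv _ hHpos.det_pos.ne'.isUnit]
  refine ⟨∑' x, ‖fourierTerm a x W‖, fun Z hZ hentry => ?_⟩
  have hZpos : (imPart Z).PosDef := Z.2.2
  have hle : (imPart Z - imPart W).PosSemidef := by
    have h := hZpos.inv.posSemidef_inv_sub_inv hHpos (by
      have h2 := hZ.add (hones.smul hK.le)
      convert h2 using 1
      rw [hH, smul_add]
      abel)
    rwa [nonsing_inv_nonsing_inv _ hZpos.det_pos.ne'.isUnit, ← imPart_imagPoint H⁻¹ hHpos.inv]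
      at h
  have hent (i j) : |(imPart Z)⁻¹ i j| ≤ |(imPart W)⁻¹ i j| := by
    refine (hentry i j).trans ((le_trans ?_) (le_abs_self _))
    rw [hWinv, hH, Matrix.smul_apply, Matrix.add_apply, vecMulVec_apply, smul_eq_mul]
    have h0 : 0 ≤ (1 : Matrix (Fin n) (Fin n) ℝ) i j := by
      rw [Matrix.one_apply]; split_ifs <;> norm_num
    simp only [Pi.one_apply]
    nlinarith
  have hval : HasSum (fun x => fourierTerm a x Z) (f Z) :=
    (hunif {Z} isCompact_singleton).hasSum (Set.mem_singleton Z)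
  rw [← hval.tsum_eq]
  exact (norm_tsum_le_tsum_norm (hsum Z)).trans
    ((hsum Z).tsum_le_tsum (fun x => norm_fourierTerm_le a x hle hent) (hsum W))

end SiegelForms

/-! ### The slash action and modular forms -/

namespace SiegelForms

open SiegelUpperHalfSpace

variable {n : ℕ}

theorem map_ofReal_mul_add_mul (A B C D : Matrix (Fin n) (Fin n) ℝ) :
    (A * B + C * D).map Complex.ofReal = A.map Complex.ofReal * B.map Complex.ofReal +
      C.map Complex.ofReal * D.map Complex.ofReal := by
  ext i j
  simp [Matrix.mul_apply]

theorem blocks_mul (g h : Sp n ℝ) :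
    blockA (g * h) = blockA g * blockA h + blockB g * blockC h ∧
    blockB (g * h) = blockA g * blockB h + blockB g * blockD h ∧
    blockC (g * h) = blockC g * blockA h + blockD g * blockC h ∧
    blockD (g * h) = blockC g * blockB h + blockD g * blockD h := by
  have hmul : (g * h).1 = fromBlocks _ _ _ _ * fromBlocks _ _ _ _ :=
    congrArg₂ (· * ·) (fromBlocks_toBlocks g.1).symm (fromBlocks_toBlocks h.1).symm
  rw [fromBlocks_multiply] at hmul
  refine ⟨?_, ?_, ?_, ?_⟩
  · rw [blockA, hmul, toBlocks_fromBlocks₁₁, map_ofReal_mul_add_mul]; rfl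
  · rw [blockB, hmul, toBlocks_fromBlocks₁₂, map_ofReal_mul_add_mul]; rfl
  · rw [blockC, hmul, toBlocks_fromBlocks₂₁, map_ofReal_mul_add_mul]; rfl
  · rw [blockD, hmul, toBlocks_fromBlocks₂₂, map_ofReal_mul_add_mul]; rfl

theorem act_coe_mul_denom (g : Sp n ℝ) (Z : SiegelUpperHalfSpace n) :
    (act g Z).1 * denomMatrix g Z = numMatrix g Z :=
  Matrix.nonsing_inv_mul_cancel_right _ _ (isUnit_det_denom g Z)

theorem numMatrix_mul (g h : Sp n ℝ) (Z : SiegelUpperHalfSpace n) :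
    numMatrix (g * h) Z = numMatrix g (act h Z) * denomMatrix h Z := by
  obtain ⟨hA, hB, -, -⟩ := blocks_mul g h
  rw [numMatrix, numMatrix, Matrix.add_mul, Matrix.mul_assoc, act_coe_mul_denom, hA, hB, numMatrix,
    denomMatrix]
  noncomm_ring

theorem denomMatrix_mul (g h : Sp n ℝ) (Z : SiegelUpperHalfSpace n) :
    denomMatrix (g * h) Z = denomMatrix g (act h Z) * denomMatrix h Z := by
  obtain ⟨-, -, hC, hD⟩ := blocks_mul g h
  rw [denomMatrix, denomMatrix, Matrix.add_mul, Matrix.mul_assoc, act_coe_mul_denom, hC, hD,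
    numMatrix, denomMatrix]
  noncomm_ring

theorem act_mul (g h : Sp n ℝ) (Z : SiegelUpperHalfSpace n) :
    act (g * h) Z = act g (act h Z) := by
  apply Subtype.ext
  change numMatrix (g * h) Z * (denomMatrix (g * h) Z)⁻¹ =
    numMatrix g (act h Z) * (denomMatrix g (act h Z))⁻¹
  rw [numMatrix_mul, denomMatrix_mul, Matrix.mul_inv_rev, ← Matrix.mul_assoc,
    Matrix.mul_nonsing_inv_cancel_right _ _ (isUnit_det_denom h Z)]

theorem autFactor_mul (g h : Sp n ℝ) (Z : SiegelUpperHalfSpace n) :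
    autFactor (g * h) Z = autFactor g (act h Z) * autFactor h Z :=
  Units.ext (denomMatrix_mul g h Z)

section Representations

variable {V : Type*} [AddCommGroup V] [Module ℂ V]
  (ρ : Representation ℂ (GeneralLinearGroup (Fin n) ℂ) V)

theorem slash_mul (F : SiegelUpperHalfSpace n → V) (g h : Sp n ℝ) :
    slash ρ F (g * h) = slash ρ (slash ρ F g) h := by
  ext Z
  rw [slash, slash, slash, autFactor_mul, act_mul, _root_.mul_inv_rev, map_mul, Module.End.mul_apply]

/-- The finitely many translates of a modular form under `Sp_{2n}(ℤ)` are uniformly bounded where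
`Y` is bounded below. -/
theorem exists_bound_slash {p : ℕ} {Γ : Subgroup (Sp n ℚ)} (hΓ : IsCongruenceSubgroup Γ)
    {F : SiegelUpperHalfSpace n → V} (hF : IsNearlyHolomorphicFormOn ρ p Γ F) {ι : Type*}
    [Finite ι] (l : ι → V →ₗ[ℂ] ℂ) {K : ℝ} (hK : 0 < K) :
    ∃ C, ∀ q ∈ spInt n, ∀ k, ∀ Z : SiegelUpperHalfSpace n,
      (K • 1 - (imPart Z)⁻¹).PosSemidef → (∀ i j, |(imPart Z)⁻¹ i j| ≤ K) →
      ‖l k (slash ρ F (spRatToReal q⁻¹) Z)‖ ≤ C := by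
  have hfin : (Γ.subgroupOf (spInt n)).FiniteIndex := ⟨hΓ.1.1⟩
  have hfinite : Finite (spInt n ⧸ Γ.subgroupOf (spInt n)) :=
    Subgroup.finite_quotient_of_finiteIndex
  choose C hC using fun x : (spInt n ⧸ Γ.subgroupOf (spInt n)) × ι =>
    (hF.niceFourierExpansion ((x.1.out : Sp n ℚ)⁻¹) (l x.2)).exists_bound hK
  obtain ⟨M, hM⟩ := Finite.exists_le C
  refine ⟨M, fun q hq k Z hZ hentry => ?_⟩
  -- Left cosets of `q` fit the slash by `q⁻¹`: if `q⁻¹c ∈ Γ`, then `F|q⁻¹ = (F|q⁻¹c)|c⁻¹ = F|c⁻¹`.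
  set c : spInt n ⧸ Γ.subgroupOf (spInt n) := QuotientGroup.mk ⟨q, hq⟩ with hc
  have hmem : q⁻¹ * (c.out : Sp n ℚ) ∈ Γ := by
    have h : (QuotientGroup.mk ⟨q, hq⟩ : spInt n ⧸ Γ.subgroupOf (spInt n)) =
        QuotientGroup.mk c.out := by rw [QuotientGroup.out_eq']
    simpa [Subgroup.mem_subgroupOf] using QuotientGroup.eq.mp h
  have heq : slash ρ F (spRatToReal q⁻¹) = slash ρ F (spRatToReal (c.out : Sp n ℚ)⁻¹) := by
    have h : q⁻¹ = q⁻¹ * (c.out : Sp n ℚ) * (c.out : Sp n ℚ)⁻¹ := by group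
    rw [h, map_mul, slash_mul, hF.transformation _ hmem]
  rw [heq]
  exact (hC (c, k) Z hZ hentry).trans (hM (c, k))

end Representations

/-! ### Growth of the lift -/

theorem spRatToReal_spMap_int (γ : Sp n ℤ) :
    spRatToReal (spMap (Int.castRingHom ℚ) γ) = spMap (Int.castRingHom ℝ) γ := by
  apply Subtype.ext
  ext i j
  simp [spRatToReal, spMap_coe]

theorem abs_lowerGram_le {g : Sp n ℝ} {c : ℝ}
    (hg : ∀ i, ∑ j, ‖denomMatrix g (basePoint n) i j‖ ^ 2 ≤ c) (i j : Fin n) :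
    |lowerGram g i j| ≤ c := by
  have hrow (i : Fin n) : ‖rowToComplex n (g.1 (Sum.inr i))‖ ^ 2 ≤ c := by
    rw [EuclideanSpace.norm_sq_eq]
    simpa only [denomMatrix_basePoint_apply] using hg i
  have h : |lowerGram g i j| ≤ ‖rowToComplex n (g.1 (Sum.inr j))‖ *
      ‖rowToComplex n (g.1 (Sum.inr i))‖ := by
    rw [← Real.norm_eq_abs, ← Complex.norm_real, lowerGram_apply_eq_inner]
    exact norm_inner_le_norm _ _
  nlinarith [hrow i, hrow j, sq_nonneg (‖rowToComplex n (g.1 (Sum.inr j))‖ -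
    ‖rowToComplex n (g.1 (Sum.inr i))‖)]

theorem posSemidef_smul_one_sub_lowerGram {g : Sp n ℝ} {c K : ℝ}
    (hg : ∀ i, ∑ j, ‖denomMatrix g (basePoint n) i j‖ ^ 2 ≤ c) (hK : n * c ≤ K) :
    (K • 1 - lowerGram g).PosSemidef := by
  have h := posSemidef_trace_smul_one_sub (g.1.submatrix Sum.inr id : Matrix (Fin n) _ ℝ)ᵀ
  rw [transpose_transpose] at h
  change ((lowerGram g).trace • (1 : Matrix (Fin n) (Fin n) ℝ) - lowerGram g).PosSemidef at h
  have htr : (lowerGram g).trace ≤ K := by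
    refine le_trans ?_ hK
    calc (lowerGram g).trace ≤ ∑ _i : Fin n, c :=
          Finset.sum_le_sum fun i _ => (le_abs_self _).trans (abs_lowerGram_le hg i i)
      _ = n * c := by simp
  have h2 := h.add ((PosSemidef.one (R := ℝ) (n := Fin n)).smul (sub_nonneg.mpr htr))
  convert h2 using 1
  rw [sub_smul]
  abel

theorem norm_denomMatrix_apply_le {g : Sp n ℝ} {c : ℝ}
    (hg : ∀ i, ∑ j, ‖denomMatrix g (basePoint n) i j‖ ^ 2 ≤ c) (i j : Fin n) :
    ‖denomMatrix g (basePoint n) i j‖ ≤ c + 1 := by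
  have h := (Finset.single_le_sum (f := fun j => ‖denomMatrix g (basePoint n) i j‖ ^ 2)
    (fun _ _ => sq_nonneg _) (Finset.mem_univ j)).trans (hg i)
  nlinarith [sq_nonneg (‖denomMatrix g (basePoint n) i j‖ - 1)]

/-- The lift of a nearly holomorphic form, multiplied by a power of the determinant of a reduced
factor of automorphy, is bounded. -/
theorem exists_bound_vecLift {V : Type*} [AddCommGroup V] [Module ℂ V] [FiniteDimensional ℂ V]
    {ρ : Representation ℂ (GeneralLinearGroup (Fin n) ℂ) V} (hrat : IsRational ρ)
    (hirr : ρ.IsIrreducible) {lam : Fin n → ℤ} {l₀ : ℤ} (hlam : ∀ i, lam i ≤ l₀)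
    (hweight : IsHighestWeight ρ lam) {F : SiegelUpperHalfSpace n → V}
    (hF : IsNearlyHolomorphicForm ρ F) (L : V →ₗ[ℂ] ℂ) :
    ∃ C, 0 ≤ C ∧ ∀ g : Sp n ℝ, ∃ γ : Sp n ℤ, ‖L (vecLift ρ F g)‖ *
      ‖(denomMatrix (spMap (Int.castRingHom ℝ) γ * g) (basePoint n)).det‖ ^ l₀ ≤ C := by
  obtain ⟨Γ, p, hΓ, hF⟩ := hF
  set c := reductionConst n with hc
  have hc0 : 0 ≤ c := reductionConst_nonneg n
  -- The summand `n * c` bounds the reduced Gram matrix as a form, via its trace, `c` bounds its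
  -- entries, and `1` makes `K` positive.
  set K : ℝ := n * c + c + 1 with hK
  have hK0 : 0 < K := by positivity
  let b := Module.finBasis ℂ V
  obtain ⟨M, hM⟩ := exists_bound_slash ρ hΓ hF b.coord hK0
  choose D hD using fun k => exists_bound_inv_mul_det hrat hirr hlam hweight L (c + 1) (b k)
  refine ⟨∑ k, |M| * |D k|, Finset.sum_nonneg fun k _ => by positivity, fun g => ?_⟩
  obtain ⟨γ, hγ⟩ := exists_reduced_denom g
  refine ⟨γ, ?_⟩
  set g' := spMap (Int.castRingHom ℝ) γ * g with hg'
  set q := spMap (Int.castRingHom ℚ) γ with hq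
  have hgq : g = spRatToReal q⁻¹ * g' := by
    rw [hg', ← spRatToReal_spMap_int, ← hq, map_inv, inv_mul_cancel_left]
  set G := slash ρ F (spRatToReal q⁻¹) with hG
  have hval : vecLift ρ F g = ρ (autFactor g' (basePoint n))⁻¹ (G (act g' (basePoint n))) := by
    conv_lhs => rw [hgq]
    exact congrFun (slash_mul ρ F (spRatToReal q⁻¹) g') (basePoint n)
  have hMk (k) : ‖b.coord k (G (act g' (basePoint n)))‖ ≤ |M| := by
    refine (hM q ⟨γ, rfl⟩ k _ ?_ fun i j => ?_).trans (le_abs_self M)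
    · rw [inv_imPart_act_basePoint]
      exact posSemidef_smul_one_sub_lowerGram hγ (by linarith)
    · rw [inv_imPart_act_basePoint]
      refine (abs_lowerGram_le hγ i j).trans ?_
      have : 0 ≤ n * c := by positivity
      linarith
  have hDk (k) : ‖L (ρ (autFactor g' (basePoint n))⁻¹ (b k))‖ *
      ‖(denomMatrix g' (basePoint n)).det‖ ^ l₀ ≤ |D k| :=
    (hD k (autFactor g' (basePoint n)) fun i j => norm_denomMatrix_apply_le hγ i j).trans
      (le_abs_self _)
  rw [hval]
  -- Expanding in a fixed basis separates the estimates: the coordinates are bounded by the Fourier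
  -- expansion, and `ρ(J)⁻¹` acts on finitely many fixed vectors.
  conv_lhs => rw [← b.sum_repr (G (act g' (basePoint n)))]
  rw [map_sum, map_sum]
  refine (mul_le_mul_of_nonneg_right (norm_sum_le _ _) (by positivity)).trans ?_
  rw [Finset.sum_mul]
  refine Finset.sum_le_sum fun k _ => ?_
  rw [map_smul, map_smul, smul_eq_mul, norm_mul, mul_assoc]
  exact mul_le_mul (hMk k) (hDk k) (by positivity) (abs_nonneg _)

end SiegelForms

/-! ### The growth exponent `nλ₁/2` -/

theorem theorem4p2 {n : ℕ} [NeZero n] {V : Type*} [AddCommGroup V] [Module ℂ V]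
    [FiniteDimensional ℂ V]
    (ρ : Representation ℂ (Matrix.GeneralLinearGroup (Fin n) ℂ) V)
    (hrat : SiegelForms.IsRational ρ) (hirr : ρ.IsIrreducible)
    (lam : Fin n → ℤ) (hlam : Antitone lam) (hlam0 : ∀ i, 0 ≤ lam i)
    (hweight : SiegelForms.IsHighestWeight ρ lam)
    (F : SiegelUpperHalfSpace n → V) (hF : SiegelForms.IsNearlyHolomorphicForm ρ F)
    (L : V →ₗ[ℂ] ℂ) :
    SiegelForms.HasModerateGrowth (fun g => L (SiegelForms.vecLift ρ F g)) ∧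
    ∃ C : ℝ, ∀ r : ℝ, (n : ℝ) * (lam 0 : ℝ) / 2 ≤ r → ∀ g : SiegelForms.Sp n ℝ,
      ‖L (SiegelForms.vecLift ρ F g)‖ ≤ C * SiegelForms.traceNorm g ^ r := by
  obtain ⟨C, hC0, hC⟩ := SiegelForms.exists_bound_vecLift hrat hirr
    (fun i => hlam (Fin.zero_le i)) hweight hF L
  have key (r : ℝ) (hr : (n : ℝ) * (lam 0 : ℝ) / 2 ≤ r) (g : SiegelForms.Sp n ℝ) :
      ‖L (SiegelForms.vecLift ρ F g)‖ ≤ C * SiegelForms.traceNorm g ^ r := by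
    obtain ⟨γ, hγ⟩ := hC g
    have hτ := SiegelForms.one_le_traceNorm g
    have h1 := SiegelForms.one_le_traceNorm_pow_mul_norm_det_sq γ g
    set τ := SiegelForms.traceNorm g with hτdef
    set d := ‖(SiegelForms.denomMatrix
      (SiegelForms.spMap (Int.castRingHom ℝ) γ * g) (SiegelUpperHalfSpace.basePoint n)).det‖
      with hd
    have hτ0 : 0 < τ := zero_lt_one.trans_le hτ
    have hd0 : 0 < d :=
      norm_pos_iff.mpr (SiegelForms.isUnit_det_denom _ _).ne_zero
    have hinv : d⁻¹ ≤ τ ^ ((n : ℝ) / 2) := by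
      rw [inv_le_iff_one_le_mul₀ hd0]
      have h2 : (τ ^ ((n : ℝ) / 2)) ^ 2 = τ ^ n := by
        rw [← Real.rpow_natCast, ← Real.rpow_mul hτ0.le, ← Real.rpow_natCast τ n]
        congr 1
        push_cast
        ring
      rw [← h2, ← mul_pow] at h1
      exact (one_le_pow_iff_of_nonneg (by positivity) two_ne_zero).mp h1
    -- Non-negativity of `lam 0` allows the bound on `d⁻¹` to be raised to that power, and `τ ≥ 1`
    -- allows any larger exponent `r` without changing the constant.
    have hpow : (d ^ lam 0)⁻¹ ≤ τ ^ r := by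
      calc (d ^ lam 0)⁻¹ = d⁻¹ ^ lam 0 := (_root_.inv_zpow _ _).symm
        _ ≤ (τ ^ ((n : ℝ) / 2)) ^ lam 0 := zpow_le_zpow_left₀ (hlam0 0) (by positivity) hinv
        _ = τ ^ ((n : ℝ) * (lam 0 : ℝ) / 2) := by
          rw [← Real.rpow_intCast, ← Real.rpow_mul hτ0.le]
          congr 1
          ring
        _ ≤ τ ^ r := Real.rpow_le_rpow_of_exponent_le hτ hr
    calc ‖L (SiegelForms.vecLift ρ F g)‖ ≤ C * (d ^ lam 0)⁻¹ :=
          (le_mul_inv_iff₀ (zpow_pos hd0 _)).mpr hγ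
      _ ≤ C * τ ^ r := mul_le_mul_of_nonneg_left hpow hC0
  -- The `+ 1` keeps the integral exponent positive when `lam 0 = 0`.
  refine ⟨⟨C, ⌈(n : ℝ) * (lam 0 : ℝ) / 2⌉₊ + 1, Nat.succ_pos _, fun g => ?_⟩, C, key⟩
  rw [← Real.rpow_natCast]
  refine key _ ((Nat.le_ceil _).trans ?_) g
  push_cast
  linarith
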